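/- **Setting.** Let $t_1,\dots,t_M\subset\mathbb{R}^d$ be compact sets with non-empty interior (the prototiles). A substitution rule $S$ on them consists of maps $f_{ijk}(y)=\theta_{ijk}y+\tau_{ijk}$, $1\le i,j\le M$, $1\le k\le\kappa(i,j)$, with $\theta_{ijk}\in(0,1]$ and $\tau_{ijk}\in\mathbb{R}^d$, such that $t_i=\bigcup_{j,k}f_{ijk}(t_j)$ for every $i$, where the sets $f_{ijk}(t_j)$ with $i$ fixed meet pairwise only along their boundaries. It is uniformly expanding, with expansion constant $\bar\theta=\theta^{-1}>1$, if $\theta_{ijk}=\theta\in(0,1)$ for all $i,j,k$. Let $S_1,\dots,S_N$ be uniformly expanding substitution rules on $t_1,\dots,t_M$ with expansion constants $\bar\theta_1,\dots,\bar\theta_N>1$. Let $\Sigma_N=\{1,\dots,N\}^{\mathbb{Z}\setminus\{0\}}$, with the shift $\sigma$. For $x\in\Sigma_N$ the Bratteli diagram $\mathcal{B}_x$ has $M$ vertices $v_1,\dots,v_M$ at each level $n\in\mathbb{Z}$; the edges between two consecutive levels are indexed by $n\in\mathbb{Z}\setminus\{0\}$ in increasing order (those from level $0$ to level $1$ having index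 $1$), and the edges $e$ of index $n$ from $v_j$ to $v_i$ correspond to the maps $f_e=f_{ijk}$ of $S_{x_n}$. The diagram $\mathcal{B}_x$ is minimal if for every level $m$ there is $\ell\ge1$ such that every vertex of level $m$ is joined to every vertex of level $m+\ell$ by a path. A $\sigma$-invariant probability measure $\mu$ on $\Sigma_N$ is minimal if $\mathcal{B}_x$ is minimal for $\mu$-almost every $x$. For a finite path $p=(e_1,\dots,e_n)$ from level $0$ to level $n$ put $f_p=f_{e_n}\circ\dots\circ f_{e_1}$, let $s(p)$ be its initial and $r(p)$ its final vertex, and write $t_{s(p)}$ for $t_j$ when $s(p)=v_j$. For an infinite path $e$ starting at level $0$ let $e|_n$ consist of its first $n$ edges; the $n$-th approximant of $e$ is the collection of the tiles $f_{e|_n}^{-1}\circ f_p(t_{s(p)})$, over all paths $p$ from level $0$ to level $n$ with $r(p)=r(e|_n)$, and $\mathcal{T}_e$ is the increasing union over $n$ of these collections. The rules $S_1,\dots,S_N$ are compatible if the prototiles admit CW structures such that, in every approximant, for every $x\in\Sigma_N$, the intersection of any two tiles is a union of (translated) closed cells of each of them. The tiling space of a tiling $\mathcal{T}$ is the closure of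 the set of its translates in the space of tilings of $\mathbb{R}^d$, for the metric in which two tilings are close when, after a small translation, they contain the same tiles inside a large ball about the origin. Let $\Omega_x$ be the tiling space of $\mathcal{T}_e$, for the infinite paths $e$ of $\mathcal{B}_x$ such that $\mathcal{T}_e$ covers $\mathbb{R}^d$ (the union over all such $e$; if $\mathcal{B}_x$ is minimal, it does not depend on $e$). Let $\Lambda_x$ be the set of return vectors, that is, of all $\tau\in\mathbb{R}^d$ for which there are $\mathcal{T}\in\Omega_x$ and tiles $A,B\in\mathcal{T}$, both translates of one prototile $t_i$, with $A+\tau=B$. **Theorem.** Let $S_1,\dots,S_N$ be $N$ uniformly expanding compatible substitution rules on the prototiles $t_1,\dots,t_M\subset\mathbb{R}^d$ with expansion constants $\bar\theta_1,\dots,\bar\theta_N>1$. Let $\mu$ be a minimal, $\sigma$-invariant, ergodic probability measure on $\Sigma_N$. Then for $\mu$-almost every $x\in\Sigma_N$ there exists a basis $\{b_1,\dots,b_d\}$ of $\mathbb{R}^d$ such that $$\Lambda_x\subset\mathbb{Z}[\bar\theta_1,\dots,\bar\theta_N]\,b_1+\dots+\mathbb{Z}[\bar\theta_1,\dots,\bar\theta_N]\,b_d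 .$$ -/

import Mathlib

namespace RandomTiling

noncomputable section

open Set

/-! ### Tilings of Euclidean space -/

/-- `ℝ^d` with its Euclidean norm. -/
abbrev Space (d : ℕ) : Type := EuclideanSpace ℝ (Fin d)

/-- The translate `A + τ` of a set. -/
def shiftSet {d : ℕ} (τ : Space d) (A : Set (Space d)) : Set (Space d) :=
  (fun y => y + τ) '' A

/-- The translate `φ_τ(T)` of a collection of tiles: every tile is translated by `τ`. -/
def translate {d : ℕ} (τ : Space d) (T : Set (Set (Space d))) : Set (Set (Space d)) :=
  shiftSet τ '' T

/-- `A` and `B` meet only along their boundaries. -/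
def MeetAlongBoundary {d : ℕ} (A B : Set (Space d)) : Prop :=
  A ∩ B ⊆ frontier A ∩ frontier B

/-- A tiling: a covering of `ℝ^d` by compact sets, any two of which meet only along their
boundaries. -/
structure IsTiling {d : ℕ} (T : Set (Set (Space d))) : Prop where
  compact : ∀ A ∈ T, IsCompact A
  cover : ⋃₀ T = univ
  boundary : ∀ A ∈ T, ∀ B ∈ T, A ≠ B → MeetAlongBoundary A B

/-- The largest patch of `T` that is completely contained in `A`. -/
def patchIn {d : ℕ} (T : Set (Set (Space d))) (A : Set (Space d)) : Set (Set (Space d)) :=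
  {t ∈ T | t ⊆ A}

/-- `T` and `T'` agree on the ball of radius `1/ε` about the origin up to a translation of size
at most `ε`. The tiling metric is the infimum of the `ε > 0` with this property (cut off at `1`). -/
def CloseUpTo {d : ℕ} (ε : ℝ) (T T' : Set (Set (Space d))) : Prop :=
  ∃ s : Space d, ‖s‖ ≤ ε ∧
    patchIn T (Metric.ball 0 (1 / ε)) = patchIn (translate s T') (Metric.ball 0 (1 / ε))

/-- The tiling space of `T`: the tilings in the closure, for the tiling metric, of the set of all
translates of `T`. -/
def hull {d : ℕ} (T : Set (Set (Space d))) : Set (Set (Set (Space d))) :=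
  {T' | IsTiling T' ∧ ∀ ε : ℝ, 0 < ε → ∃ r : Space d, CloseUpTo ε T' (translate r T)}

/-- Translation equivalence of tiles. -/
def TransEquiv {d : ℕ} (A B : Set (Space d)) : Prop := ∃ τ : Space d, shiftSet τ A = B

/-- The return vectors of type `i`: the vectors that translate a tile of `T` onto a tile of `T`,
both being translation-equivalent to the prototile `t i`. -/
def returnVectorsOfType {d M : ℕ} (t : Fin M → Set (Space d)) (T : Set (Set (Space d)))
    (i : Fin M) : Set (Space d) :=
  {τ | ∃ A ∈ T, ∃ B ∈ T, TransEquiv A (t i) ∧ TransEquiv B (t i) ∧ shiftSet τ A = B}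

/-- The return vectors of a tiling. -/
def returnVectors {d M : ℕ} (t : Fin M → Set (Space d)) (T : Set (Set (Space d))) :
    Set (Space d) :=
  ⋃ i : Fin M, returnVectorsOfType t T i

/-! ### Substitution rules -/

/-- A substitution rule on the prototiles `t 1, …, t M`: affine maps
`f i j k (y) = scale i j k • y + shift i j k`, for `k < κ i j`, such that `t i` is tiled by the
sets `f i j k (t j)`. -/
structure SubstitutionRule {d M : ℕ} (t : Fin M → Set (Space d)) where
  κ : Fin M → Fin M → ℕ
  scale : ∀ i j : Fin M, Fin (κ i j) → ℝ
  shift : ∀ i j : Fin M, Fin (κ i j) → Space d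
  scale_pos : ∀ i j k, 0 < scale i j k
  scale_le_one : ∀ i j k, scale i j k ≤ 1
  union_eq : ∀ i, t i = ⋃ j : Fin M, ⋃ k : Fin (κ i j),
    (fun y => scale i j k • y + shift i j k) '' t j
  boundary : ∀ i (p q : Σ j : Fin M, Fin (κ i j)), p ≠ q →
    MeetAlongBoundary ((fun y => scale i p.1 p.2 • y + shift i p.1 p.2) '' t p.1)
      ((fun y => scale i q.1 q.2 • y + shift i q.1 q.2) '' t q.1)

/-- The affine map `f i j k` of a substitution rule. -/
def SubstitutionRule.f {d M : ℕ} {t : Fin M → Set (Space d)} (S : SubstitutionRule t)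
    (i j : Fin M) (k : Fin (S.κ i j)) (y : Space d) : Space d :=
  S.scale i j k • y + S.shift i j k

/-- `S` is uniformly expanding with contraction constant `θ ∈ (0, 1)` (that is, with expansion
constant `θ⁻¹`). -/
def SubstitutionRule.IsUniformlyExpanding {d M : ℕ} {t : Fin M → Set (Space d)}
    (S : SubstitutionRule t) (θ : ℝ) : Prop :=
  0 < θ ∧ θ < 1 ∧ ∀ i j k, S.scale i j k = θ

/-! ### The full shift -/

/-- The nonzero integers. -/
abbrev NonzeroInt : Type := {n : ℤ // n ≠ 0}

/-- The predecessor of a nonzero integer among the nonzero integers. -/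
def NonzeroInt.pred (n : NonzeroInt) : NonzeroInt :=
  ⟨if n.1 = 1 then -1 else n.1 - 1, by
    split_ifs with h
    · decide
    · exact fun h' => h (by linarith)⟩

/-- The full `N`-shift: sequences of symbols indexed by the nonzero integers, with the product
σ-algebra. -/
abbrev FullShift (N : ℕ) : Type := NonzeroInt → Fin N

/-- The right shift `σ`; in particular `(σ x)_1 = x_{-1}`. -/
def shiftMap (N : ℕ) (x : FullShift N) : FullShift N := fun n => x n.pred

/-- The index of the edges between the vertex levels `j` and `j + 1` of a bi-infinite diagram:
the edge levels are numbered by the nonzero integers, so it is `j + 1` for `j ≥ 0` and `j` for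
`j < 0`. -/
def edgeLevel (j : ℤ) : NonzeroInt :=
  ⟨if 0 ≤ j then j + 1 else j, by split_ifs <;> omega⟩

/-- The symbols of `x` read upwards from the vertex level `m`. -/
def fromLevel {N : ℕ} (x : FullShift N) (m : ℤ) (n : ℕ) : Fin N := x (edgeLevel (m + n))

/-- The positive part `(x_1, x_2, …)` of `x`. -/
def positivePart {N : ℕ} (x : FullShift N) : ℕ → Fin N := fromLevel x 0

/-! ### Paths in the Bratteli diagram

There are `M` vertices at every level; with `w` the sequence of symbols read from some level on,
the edges from `v_j` at the `n`-th to `v_i` at the `(n+1)`-st of these levels are the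
`k : Fin (κ i j)` for the rule `S (w n)`. -/

/-- `Path S w n v` is the type of the paths made up of the first `n` edges that end at the
vertex `v`. -/
inductive Path {d M N : ℕ} {t : Fin M → Set (Space d)} (S : Fin N → SubstitutionRule t)
    (w : ℕ → Fin N) : ℕ → Fin M → Type
  | nil (v : Fin M) : Path S w 0 v
  | snoc {n : ℕ} {u : Fin M} (p : Path S w n u) (v : Fin M) (k : Fin ((S (w n)).κ v u)) :
      Path S w (n + 1) v

/-- The vertex at which a path starts. -/
def Path.source {d M N : ℕ} {t : Fin M → Set (Space d)} {S : Fin N → SubstitutionRule t}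
    {w : ℕ → Fin N} : {n : ℕ} → {v : Fin M} → Path S w n v → Fin M
  | _, _, .nil v => v
  | _, _, .snoc p _ _ => p.source

/-- The map `f_{e_n} ∘ ⋯ ∘ f_{e_1}` of a path `(e_1, …, e_n)`. -/
def Path.map {d M N : ℕ} {t : Fin M → Set (Space d)} {S : Fin N → SubstitutionRule t}
    {w : ℕ → Fin N} : {n : ℕ} → {v : Fin M} → Path S w n v → Space d → Space d
  | _, _, .nil _ => id
  | _, _, .snoc (n := n) (u := u) p v k => (S (w n)).f v u k ∘ p.map

/-- An infinite path: its vertices and its edges. -/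
structure InfPath {d M N : ℕ} {t : Fin M → Set (Space d)} (S : Fin N → SubstitutionRule t)
    (w : ℕ → Fin N) where
  vertex : ℕ → Fin M
  edge : ∀ n : ℕ, Fin ((S (w n)).κ (vertex (n + 1)) (vertex n))

/-- The first `n` edges of an infinite path. -/
def InfPath.trunc {d M N : ℕ} {t : Fin M → Set (Space d)} {S : Fin N → SubstitutionRule t}
    {w : ℕ → Fin N} (e : InfPath S w) : (n : ℕ) → Path S w n (e.vertex n)
  | 0 => .nil (e.vertex 0)
  | n + 1 => .snoc (e.trunc n) (e.vertex (n + 1)) (e.edge n)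

/-- The Bratteli diagram of `x` is minimal: for every level `m` there is an `ℓ` such that every
vertex of level `m` is joined to every vertex of level `m + ℓ`. -/
def IsMinimal {d M N : ℕ} {t : Fin M → Set (Space d)} (S : Fin N → SubstitutionRule t)
    (x : FullShift N) : Prop :=
  ∀ m : ℤ, ∃ ℓ : ℕ, 0 < ℓ ∧ ∀ u v : Fin M, ∃ p : Path S (fromLevel x m) ℓ v, p.source = u

/-! ### The tilings -/

/-- The tile `f_{e|n}⁻¹ ∘ f_p (t_{s(p)})`, more generally `f_{e|n}⁻¹ ∘ f_p (A)`. -/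
def placed {d M N : ℕ} {t : Fin M → Set (Space d)} {S : Fin N → SubstitutionRule t}
    {w : ℕ → Fin N} (e : InfPath S w) {n : ℕ} (p : Path S w n (e.vertex n))
    (A : Set (Space d)) : Set (Space d) :=
  (e.trunc n).map ⁻¹' (p.map '' A)

/-- The tiles of the `n`-th approximant of an infinite path `e`: one for every path `p` with `n`
edges and with the same range as the truncation `e|n`. -/
def approximant {d M N : ℕ} {t : Fin M → Set (Space d)} {S : Fin N → SubstitutionRule t}
    {w : ℕ → Fin N} (e : InfPath S w) (n : ℕ) : Set (Set (Space d)) :=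
  range fun p : Path S w n (e.vertex n) => placed e p (t p.source)

/-- The increasing union of the approximants. -/
def tilingOf {d M N : ℕ} {t : Fin M → Set (Space d)} {S : Fin N → SubstitutionRule t}
    {w : ℕ → Fin N} (e : InfPath S w) : Set (Set (Space d)) :=
  ⋃ n : ℕ, approximant e n

/-- The tiling space of `x`: the tiling spaces of the tilings `tilingOf e`, over the infinite
paths `e` of the positive part of the diagram for which `tilingOf e` covers `ℝ^d` (when the
diagram is minimal, all these `e` give the same tiling space). The translation of `tilingOf e` by
a vector defined by the negative part of a bi-infinite path does not change its tiling space. -/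
def tilingSpace {d M N : ℕ} {t : Fin M → Set (Space d)} (S : Fin N → SubstitutionRule t)
    (x : FullShift N) : Set (Set (Set (Space d))) :=
  {T | ∃ e : InfPath S (positivePart x), ⋃₀ tilingOf e = univ ∧ T ∈ hull (tilingOf e)}

/-- The set `Λ_x` of return vectors of the tilings in the tiling space of `x`. -/
def returnVectorsAt {d M N : ℕ} {t : Fin M → Set (Space d)} (S : Fin N → SubstitutionRule t)
    (x : FullShift N) : Set (Space d) :=
  ⋃ T ∈ tilingSpace S x, returnVectors t T

/-! ### Compatibility -/

/-- `A` is a union of (closed) cells of the CW complex `C`. -/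
def IsUnionOfCells {X : Type} [TopologicalSpace X] (C : Set X) [Topology.CWComplex C]
    (A : Set X) : Prop :=
  ∃ I : ∀ n : ℕ, Set (Topology.RelCWComplex.cell C n),
    A = ⋃ n : ℕ, ⋃ j ∈ I n, Topology.RelCWComplex.closedCell (C := C) n j

/-- Compatibility: the prototiles have CW structures such that, in every approximant for every
`x`, the intersection of any two tiles is a union of subcells of either of them. (For uniformly
expanding rules the tiles are translates of prototiles, with the translated cells.) -/
def Compatible {d M N : ℕ} {t : Fin M → Set (Space d)} (S : Fin N → SubstitutionRule t) : Prop :=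
  ∃ cw : ∀ i : Fin M, Topology.CWComplex (t i),
    ∀ (x : FullShift N) (e : InfPath S (positivePart x)) (n : ℕ)
      (p q : Path S (positivePart x) n (e.vertex n)), p ≠ q →
      ∃ A B : Set (Space d),
        @IsUnionOfCells _ _ (t p.source) (cw p.source) A ∧
        @IsUnionOfCells _ _ (t q.source) (cw q.source) B ∧
        placed e p (t p.source) ∩ placed e q (t q.source) = placed e p A ∧
        placed e p (t p.source) ∩ placed e q (t q.source) = placed e q B

end

end RandomTiling

/-! Let `R` be the ring generated by the expansion constants. Every prototile gets a control point,
and a return vector turns out to be a combination, with coefficients in `R`, of the finitely many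
displacements from the control point of a tile to that of a subtile (`Path.displacement_mem`). Hence
it suffices to place this finite set `H` in the `R`-span of a single real basis. The obstacle is
that `H` could span more than `d` dimensions over the fraction field `K` of `R`. By
`exists_basis_of_rigid` this is excluded once every `K`-linear functional `L` agrees on `H` with a
real-linear one.

That is `rigidity`, proved by differentiation. Refine one prototile indefinitely by the rules of the
past `x_{-1}, x_{-2}, …`. Compatibility leaves finitely many normalised displacements between
neighbouring tiles, and `L` commutes with the contractions, so between neighbouring control points
`L` varies by at most a constant times the scale. Chains of tiles along segments then make `L`
Lipschitz on the control points in a ball. A Lipschitz extension is differentiable somewhere in the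
ball, by Rademacher's theorem. By Poincaré recurrence and minimality, every edge of the positive
part of `x` reappears at arbitrarily small scales, at bounded relative depth, inside the tiles
around that point. Rescaling shows that `L` equals the derivative on `H`. -/

namespace RandomTiling

noncomputable section

open Set

/-! ### Compact CW complexes -/

section CW

variable {X : Type} [TopologicalSpace X]

open Topology RelCWComplex

/-- A compact CW complex has only finitely many cells. -/
theorem finite_cells_of_isCompact [T2Space X] (C : Set X) [Topology.CWComplex C] (hC : IsCompact C) :
    Finite (Σ n, cell C n) := by
  -- The set of centres of cells meets each closed cell in finitely many points, so all its subsets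
  -- are closed: it is discrete and compact, hence finite.
  let pt : (Σ n, cell C n) → X := fun i => map i.1 i.2 0
  have hpt : ∀ i, pt i ∈ openCell i.1 i.2 := fun i => map_zero_mem_openCell i.1 i.2
  have hinj : Function.Injective pt := by
    intro i j hij
    by_contra hne
    exact Set.disjoint_left.1 (disjoint_openCell_of_ne (C := C) (D := ∅) hne) (hpt i)
      (hij ▸ hpt j)
  have hfin : ∀ n (j : cell C n), (range pt ∩ closedCell n j).Finite := by
    intro n j
    obtain ⟨I, hI⟩ := CWComplex.cellFrontier_subset_finite_openCell (C := C) n j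
    have hsub : range pt ∩ closedCell n j ⊆
        insert (pt ⟨n, j⟩) (⋃ m : Fin n, (fun k => pt ⟨m, k⟩) '' (I m : Set (cell C m))) := by
      rintro _ ⟨⟨i, rfl⟩, hi⟩
      rw [← cellFrontier_union_openCell_eq_closedCell] at hi
      rcases hi with hi | hi
      · have := hI hi
        simp only [mem_iUnion] at this
        obtain ⟨m, hm, k, hk, hik⟩ := this
        have heq : i = ⟨m, k⟩ := by
          by_contra hne
          exact Set.disjoint_left.1 (disjoint_openCell_of_ne (C := C) (D := ∅) hne) (hpt i) hik
        right
        simp only [mem_iUnion]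
        exact ⟨⟨m, hm⟩, k, hk, by rw [heq]⟩
      · have heq : i = ⟨n, j⟩ := by
          by_contra hne
          exact Set.disjoint_left.1 (disjoint_openCell_of_ne (C := C) (D := ∅) hne) (hpt i) hi
        left; rw [heq]
    refine Finite.subset (Finite.insert _ (finite_iUnion fun m => ?_)) hsub
    exact (I m).finite_toSet.image _
  have hclosed : ∀ A ⊆ range pt, IsClosed A := by
    intro A hA
    have hAC : A ⊆ C := by
      refine hA.trans ?_
      rintro _ ⟨i, rfl⟩
      exact (openCell_subset_complex i.1 i.2) (hpt i)
    rw [CWComplex.closed C A hAC]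
    intro n j
    exact ((hfin n j).subset (inter_subset_inter_left _ hA)).isClosed
  have hcomp : IsCompact (range pt) := by
    refine hC.of_isClosed_subset (hclosed _ subset_rfl) ?_
    rintro _ ⟨i, rfl⟩
    exact (openCell_subset_complex i.1 i.2) (hpt i)
  have hdisc : DiscreteTopology (range pt) := by
    rw [discreteTopology_iff_forall_isClosed]
    intro s
    have := hclosed (Subtype.val '' s) (by rintro _ ⟨y, _, rfl⟩; exact y.2)
    have h2 := this.preimage (continuous_subtype_val (p := (· ∈ range pt)))
    rwa [preimage_image_eq _ Subtype.val_injective] at h2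
  have hfr : (range pt).Finite := hcomp.finite (isDiscrete_iff_discreteTopology.2 hdisc)
  exact (Set.finite_range_iff hinj).1 hfr

/-- A compact CW complex has only finitely many unions of cells. -/
theorem finite_unionsOfCells [T2Space X] (C : Set X) [Topology.CWComplex C] (hC : IsCompact C) :
    {A | IsUnionOfCells C A}.Finite := by
  have := finite_cells_of_isCompact C hC
  let F : Set (Σ n, cell C n) → Set X := fun J => ⋃ i ∈ J, closedCell (C := C) i.1 i.2
  refine (Set.finite_range F).subset ?_
  rintro A ⟨I, rfl⟩
  refine ⟨{i | i.2 ∈ I i.1}, ?_⟩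
  ext z
  simp only [F, mem_iUnion, mem_ofPred_eq, Sigma.exists, exists_prop]

theorem IsUnionOfCells.subset {C A : Set X} [Topology.CWComplex C] (h : IsUnionOfCells C A) :
    A ⊆ C := by
  obtain ⟨I, rfl⟩ := h
  refine iUnion_subset fun n => iUnion₂_subset fun j _ => ?_
  exact closedCell_subset_complex (C := C) n j

end CW

/-! ### Lexicographic minima -/

/-- The strict lexicographic order on `ℝ^d`. -/
def LexLT {d : ℕ} (y z : Space d) : Prop := ∃ i, (∀ j < i, y j = z j) ∧ y i < z i

theorem LexLT.asymm {d : ℕ} {y z : Space d} (h : LexLT y z) (h' : LexLT z y) : False := by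
  obtain ⟨i, hi, hi'⟩ := h
  obtain ⟨j, hj, hj'⟩ := h'
  rcases lt_trichotomy i j with hij | rfl | hij
  · have := hj i hij; linarith
  · linarith
  · have := hi j hij; linarith

theorem LexLT.affine {d : ℕ} {y z : Space d} (h : LexLT y z) {a : ℝ} (ha : 0 < a)
    (u : Space d) : LexLT (a • y + u) (a • z + u) := by
  obtain ⟨i, hi, hi'⟩ := h
  refine ⟨i, fun j hj => ?_, ?_⟩
  · simp [hi j hj]
  · simpa using (mul_lt_mul_iff_right₀ ha).2 hi'

/-- The lexicographic minimum respects translations and positive homotheties (`LexLT.affine`), which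
makes it a canonical control point. -/
theorem exists_lexMin {d : ℕ} {A : Set (Space d)} (hA : IsCompact A) (hne : A.Nonempty) :
    ∃ z ∈ A, ∀ y ∈ A, z = y ∨ LexLT z y := by
  -- `B` consists of the points that are lexicographically minimal in the first `k` coordinates;
  -- each step minimises one more coordinate over a compact set.
  have key : ∀ k ≤ d, ∃ B ⊆ A, IsCompact B ∧ B.Nonempty ∧ ∀ z ∈ B, ∀ y ∈ A,
      LexLT z y ∨ (y ∈ B ∧ ∀ i : Fin d, i.1 < k → z i = y i) := by
    intro k
    induction k with
    | zero => exact fun _ => ⟨A, subset_rfl, hA, hne, fun z _ y hy => Or.inr ⟨hy, by simp⟩⟩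
    | succ k ih =>
      intro hk
      obtain ⟨B, hBA, hB, hBne, hBlex⟩ := ih (by omega)
      let κ : Fin d := ⟨k, by omega⟩
      have hcont : Continuous fun z : Space d => z κ := by fun_prop
      obtain ⟨z₀, hz₀, hmin⟩ := hB.exists_isMinOn hBne hcont.continuousOn
      refine ⟨B ∩ {z | z κ = z₀ κ}, inter_subset_left.trans hBA,
        hB.inter_right (isClosed_eq hcont continuous_const), ⟨z₀, hz₀, rfl⟩, ?_⟩
      rintro z ⟨hz, hzk⟩ y hy
      rcases hBlex z hz y hy with h | ⟨hyB, heq⟩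
      · exact Or.inl h
      · have h1 : z₀ κ ≤ y κ := hmin hyB
        rcases h1.lt_or_eq with h1 | h1
        · left
          exact ⟨κ, fun j hj => heq j hj, by rw [show z κ = z₀ κ from hzk]; exact h1⟩
        · right
          refine ⟨⟨hyB, h1.symm⟩, fun i hi => ?_⟩
          rcases Nat.lt_succ_iff_lt_or_eq.1 hi with hi | hi
          · exact heq i hi
          · have : i = κ := Fin.ext hi
            rw [this, ← h1]; exact hzk
  obtain ⟨B, hBA, -, ⟨z, hz⟩, h⟩ := key d le_rfl
  refine ⟨z, hBA hz, fun y hy => ?_⟩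
  rcases h z hz y hy with h | ⟨-, h⟩
  · exact Or.inr h
  · left; ext i; exact h i i.2

/-! ### Control points of the prototiles. -/

/-- Control points for the prototiles: they are compatible with translations between prototiles
and every substitution rule has a control point of a subtile at the control point of the tile. -/
theorem exists_controlPoints {d M N : ℕ} {t : Fin M → Set (Space d)}
    (ht : ∀ i, IsCompact (t i)) (ht' : ∀ i, (interior (t i)).Nonempty)
    (S : Fin N → SubstitutionRule t) :
    ∃ c : Fin M → Space d, (∀ i, c i ∈ t i) ∧
      (∀ l i, ∃ j, ∃ k : Fin ((S l).κ i j), (S l).f i j k (c j) = c i) ∧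
      ∀ i j u, shiftSet u (t i) = t j → c i + u = c j := by
  choose c hc hmin using fun i =>
    exists_lexMin (ht i) ((ht' i).mono interior_subset)
  refine ⟨c, hc, fun l i => ?_, fun i j u h => ?_⟩
  · have h1 := hc i
    rw [(S l).union_eq i] at h1
    simp only [mem_iUnion, mem_image] at h1
    obtain ⟨j, k, y, hy, hyc⟩ := h1
    refine ⟨j, k, ?_⟩
    have hmem : (S l).f i j k (c j) ∈ t i := by
      rw [(S l).union_eq i]
      simp only [mem_iUnion, mem_image]
      exact ⟨j, k, c j, hc j, rfl⟩
    -- If `y` were not the minimum of `t j`, the point `f (c j)` of `t i` would lie strictly below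
    -- `c i`.
    rcases hmin j y hy with h2 | h2
    · rw [h2]; exact hyc
    · have h3 := h2.affine ((S l).scale_pos i j k) ((S l).shift i j k)
      rw [hyc] at h3
      rcases hmin i _ hmem with h4 | h4
      · exact h4.symm
      · exact (h4.asymm h3).elim
  · have hmem : c i + u ∈ t j := h ▸ ⟨c i, hc i, rfl⟩
    have hmem' : c j ∈ shiftSet u (t i) := h ▸ hc j
    obtain ⟨y, hy, hyc⟩ := hmem'
    rcases hmin i y hy with h2 | h2
    · rw [h2]; exact hyc
    · have h3 := h2.affine one_pos u
      simp only [one_smul] at h3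
      have h5 : y + u = c j := hyc
      rw [h5] at h3
      rcases hmin j _ hmem with h4 | h4
      · exact h4.symm
      · exact (h4.asymm h3).elim

/-! ### Modules over a ring of real numbers -/

/-- Finitely many elements of the fraction field of `R` have a common denominator in `R`. -/
theorem exists_common_denominator (R : Subring ℝ) (A : Finset ℝ)
    (hA : ∀ a ∈ A, a ∈ Subfield.closure (R : Set ℝ)) :
    ∃ D ∈ R, D ≠ 0 ∧ ∀ a ∈ A, D * a ∈ R := by
  induction A using Finset.induction_on with
  | empty => exact ⟨1, R.one_mem, one_ne_zero, by simp⟩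
  | insert a A _ ih =>
    obtain ⟨D, hD, hD0, h⟩ := ih fun b hb => hA b (Finset.mem_insert_of_mem hb)
    obtain ⟨p, hp, q, hq, hpq⟩ := Subfield.mem_closure_iff.1 (hA a (Finset.mem_insert_self _ _))
    rw [Subring.closure_eq] at hp hq
    -- The description of the closure admits the denominator `0`; the quotient is then `0`.
    by_cases hq0 : q = 0
    · refine ⟨D, hD, hD0, fun b hb => ?_⟩
      rcases Finset.mem_insert.1 hb with rfl | hb
      · rw [← hpq, hq0]; simp [R.zero_mem]
      · exact h b hb
    · refine ⟨D * q, R.mul_mem hD hq, mul_ne_zero hD0 hq0, fun b hb => ?_⟩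
      rcases Finset.mem_insert.1 hb with rfl | hb
      · rw [← hpq, show D * q * (p / q) = D * p by field_simp]
        exact R.mul_mem hD hp
      · rw [show D * q * b = q * (D * b) by ring]
        exact R.mul_mem hq (h b hb)

/-- If on a finite set `H` all functionals that are linear over the fraction field of `R` agree
with real functionals, then `H` is contained in the `R`-span of a real basis. -/
theorem exists_basis_of_rigid {d : ℕ} (R : Subring ℝ) {H : Set (Space d)} (hH : H.Finite)
    (hrig : ∀ L : Space d →ₗ[Subfield.closure (R : Set ℝ)] ℝ,
      ∃ ℓ : Space d →ₗ[ℝ] ℝ, ∀ h ∈ H, L h = ℓ h) :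
    ∃ b : Module.Basis (Fin d) ℝ (Space d), ∀ h ∈ H, ∃ c : Fin d → ℝ,
      (∀ i, c i ∈ R) ∧ h = ∑ i, c i • b i := by
  set K := Subfield.closure (R : Set ℝ) with hK
  obtain ⟨B, hBH, hspan, hind'⟩ := exists_linearIndependent K H
  have hind : LinearIndepOn K id B := hind'
  have hindR : LinearIndepOn ℝ id B := by
    change LinearIndependent ℝ ((↑) : B → Space d)
    rw [linearIndependent_iff']
    intro s g hg i hi
    classical
    let bK := Module.Basis.extend hind
    let i' : hind.extend (subset_univ B) := ⟨i, hind.subset_extend _ i.2⟩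
    -- The `K`-linear functional dual to `i` is real-linear on `B`, by rigidity; applied to a real
    -- relation on `B` it isolates the coefficient `g i`.
    let L : Space d →ₗ[K] ℝ := bK.constr K fun j => if j = i' then (1 : ℝ) else 0
    have hL : ∀ j : B, L j = if j = i then (1 : ℝ) else 0 := by
      intro j
      have h1 : bK ⟨j, hind.subset_extend _ j.2⟩ = (j : Space d) := by
        rw [Module.Basis.extend_apply_self]
      rw [← h1, Module.Basis.constr_basis]
      simp [i', Subtype.ext_iff]
    obtain ⟨ℓ, hℓ⟩ := hrig L
    have h2 := congrArg ℓ hg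
    simp only [map_sum, map_smul, map_zero] at h2
    rw [Finset.sum_congr rfl fun j _ => by rw [← hℓ j (hBH j.2), hL j]] at h2
    simpa [hi] using h2
  let b0 := Module.Basis.extend hindR
  have hfin : Finite (hindR.extend (subset_univ B)) := Module.Finite.finite_basis b0
  have := Fintype.ofFinite (hindR.extend (subset_univ B))
  have hcard : Fintype.card (hindR.extend (subset_univ B)) = d := by
    rw [← Module.finrank_eq_card_basis b0]; simp
  let b1 : Module.Basis (Fin d) ℝ (Space d) := b0.reindex (Fintype.equivFinOfCardEq hcard)
  have hB1 : ∀ v ∈ B, ∃ i, b1 i = v := by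
    intro v hv
    refine ⟨Fintype.equivFinOfCardEq hcard ⟨v, hindR.subset_extend _ hv⟩, ?_⟩
    simp [b1, b0]
  -- The expansion of `h` over `K` in `B` is also its expansion in the real basis that extends `B`.
  have hrepr : ∀ h ∈ H, ∀ i, b1.repr h i ∈ K := by
    intro h hh
    have h1 : h ∈ Submodule.span K B := hspan ▸ Submodule.subset_span hh
    clear hh
    induction h1 using Submodule.span_induction with
    | mem x hx =>
      intro i
      obtain ⟨j, rfl⟩ := hB1 x hx
      rw [Module.Basis.repr_self, Finsupp.single_apply]
      split_ifs
      · exact K.one_mem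
      · exact K.zero_mem
    | zero => intro i; simp
    | add x y _ _ hx hy => intro i; simpa using K.add_mem (hx i) (hy i)
    | smul a x _ hx =>
      intro i
      have : a • x = (a : ℝ) • x := rfl
      rw [this, map_smul]
      simpa using K.mul_mem a.2 (hx i)
  obtain ⟨D, -, hD0, hDR⟩ := exists_common_denominator R
    ((hH.toFinset ×ˢ Finset.univ).image fun p : Space d × Fin d => b1.repr p.1 p.2) (by
      intro a ha
      simp only [Finset.mem_image, Finset.mem_product, Finite.mem_toFinset] at ha
      obtain ⟨p, hp, rfl⟩ := ha
      exact hrepr _ hp.1 _)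
  -- Dividing the basis by a common denominator `D` multiplies the coordinates by `D`.
  refine ⟨b1.isUnitSMul (w := fun _ => D⁻¹) fun _ => (inv_ne_zero hD0).isUnit, fun h hh =>
    ⟨fun i => D * b1.repr h i, fun i => hDR _ ?_, ?_⟩⟩
  · exact Finset.mem_image.2 ⟨(h, i), by simpa using hh, rfl⟩
  · conv_lhs => rw [← b1.sum_repr h]
    refine Finset.sum_congr rfl fun i _ => ?_
    rw [Module.Basis.isUnitSMul_apply, smul_smul]
    congr 1
    field_simp

/-! ### Packing and chains -/

/-- The number of points of a separated set in a ball is bounded. -/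
theorem exists_packing_bound {E : Type*} [PseudoMetricSpace E] [ProperSpace E] (a : E)
    (r : ℝ) {ρ : ℝ} (hρ : 0 < ρ) :
    ∃ m : ℕ, ∀ (ι : Type) (f : ι → E), (∀ i, f i ∈ Metric.closedBall a r) →
      (∀ i j, i ≠ j → ρ ≤ dist (f i) (f j)) → Finite ι ∧ Nat.card ι ≤ m := by
  -- A ball of radius `ρ / 2` holds at most one point, so the size of this cover is a bound valid
  -- for all families.
  obtain ⟨T, -, hT, hcov⟩ := (isCompact_closedBall a r).finite_cover_balls (half_pos hρ)
  have := hT.to_subtype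
  refine ⟨Nat.card T, fun ι f hf hsep => ?_⟩
  have : ∀ i, ∃ c : T, f i ∈ Metric.ball (c : E) (ρ / 2) := by
    intro i
    have := hcov (hf i)
    simp only [mem_iUnion] at this
    obtain ⟨c, hc, h⟩ := this
    exact ⟨⟨c, hc⟩, h⟩
  choose g hg using this
  have hinj : Function.Injective g := by
    intro i j hij
    by_contra hne
    have h1 := hsep i j hne
    have h2 := hg i
    have h3 := hg j
    rw [← hij] at h3
    rw [Metric.mem_ball] at h2 h3
    have := dist_triangle_right (f i) (f j) (g i : E)
    linarith
  exact ⟨Finite.of_injective g hinj, Nat.card_le_card_of_injective g hinj⟩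

/-- A function on the index set of a finite closed cover of a connected set, changing by at
most `δ` between members that meet, varies by at most `δ` times the size of the cover. -/
theorem abs_sub_le_of_chain {E ι : Type*} [TopologicalSpace E] [Finite ι] {I : Set E}
    (hI : IsPreconnected I) (A : ι → Set E) (hA : ∀ i, IsClosed (A i))
    (hcov : I ⊆ ⋃ i, A i) (hmeet : ∀ i, (I ∩ A i).Nonempty) (g : ι → ℝ) {δ : ℝ} (hδ : 0 ≤ δ)
    (hg : ∀ i j, (A i ∩ A j).Nonempty → |g i - g j| ≤ δ) (i j : ι) :
    |g i - g j| ≤ Nat.card ι * δ := by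
  classical
  have := Fintype.ofFinite ι
  -- The intersection graph is connected: otherwise the members reachable from `i` and the remaining
  -- ones would have disjoint closed unions that both meet `I` and together cover it.
  let G : SimpleGraph ι := SimpleGraph.fromRel fun i j => (A i ∩ A j).Nonempty
  have hreach : ∀ k, G.Reachable i k := by
    by_contra! hcon
    obtain ⟨k, hk⟩ := hcon
    have h := (isPreconnected_closed_iff.1 hI) (⋃ a ∈ {a | G.Reachable i a}, A a)
      (⋃ a ∈ {a | ¬ G.Reachable i a}, A a)
      (Set.Finite.isClosed_biUnion (Set.toFinite _) fun a _ => hA a)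
      (Set.Finite.isClosed_biUnion (Set.toFinite _) fun a _ => hA a)
      (by
        intro x hx
        obtain ⟨a, ha⟩ := mem_iUnion.1 (hcov hx)
        by_cases hr : G.Reachable i a
        · exact Or.inl (mem_biUnion (show a ∈ {a | G.Reachable i a} from hr) ha)
        · exact Or.inr (mem_biUnion (show a ∈ {a | ¬ G.Reachable i a} from hr) ha))
      (by
        obtain ⟨x, hx, hx'⟩ := hmeet i
        exact ⟨x, hx, mem_biUnion (show i ∈ {a | G.Reachable i a} from .refl i) hx'⟩)
      (by
        obtain ⟨x, hx, hx'⟩ := hmeet k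
        exact ⟨x, hx, mem_biUnion (show k ∈ {a | ¬ G.Reachable i a} from hk) hx'⟩)
    obtain ⟨x, -, hx1, hx2⟩ := h
    simp only [mem_iUnion] at hx1 hx2
    obtain ⟨a, ha, hxa⟩ := hx1
    obtain ⟨b, hb, hxb⟩ := hx2
    refine hb (ha.trans (SimpleGraph.Adj.reachable ?_))
    rw [SimpleGraph.fromRel_adj]
    refine ⟨?_, Or.inl ⟨x, hxa, hxb⟩⟩
    rintro rfl
    exact hb ha
  have hwalk : ∀ {a b : ι} (p : G.Walk a b), |g a - g b| ≤ p.length * δ := by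
    intro a b p
    induction p with
    | nil => simp
    | @cons u v w h p ih =>
      have h1 : |g u - g v| ≤ δ := by
        rw [SimpleGraph.fromRel_adj] at h
        rcases h.2 with h | h
        · exact hg _ _ h
        · rw [abs_sub_comm]; exact hg _ _ h
      have h2 := abs_sub_le (g u) (g v) (g w)
      rw [SimpleGraph.Walk.length_cons]
      push_cast
      linarith
  obtain ⟨p, hp⟩ := (hreach j).exists_isPath
  refine (hwalk p).trans (mul_le_mul_of_nonneg_right ?_ hδ)
  have := hp.length_lt
  rw [Nat.card_eq_fintype_card]
  exact_mod_cast this.le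

/-! ### Recurrence -/

theorem NonzeroInt.pred_edgeLevel (j : ℤ) :
    NonzeroInt.pred (edgeLevel j) = edgeLevel (j - 1) := by
  apply Subtype.ext
  simp only [NonzeroInt.pred, edgeLevel]
  split_ifs <;> omega

/-- Iterating `σ` reads `x` further down, so returns under `σ` are recurrences in the past. -/
theorem shiftMap_iterate_edgeLevel {N : ℕ} (x : FullShift N) (n : ℕ) (j : ℤ) :
    (shiftMap N)^[n] x (edgeLevel j) = x (edgeLevel (j - n)) := by
  induction n generalizing j with
  | zero => simp
  | succ n ih =>
    rw [Function.iterate_succ_apply', shiftMap, NonzeroInt.pred_edgeLevel, ih]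
    congr 2
    push_cast
    ring

/-- Almost surely, every word of `x` recurs infinitely often in the past. -/
theorem ae_recurrent {N : ℕ} (μ : MeasureTheory.Measure (FullShift N))
    [MeasureTheory.IsFiniteMeasure μ] (hμ : MeasureTheory.MeasurePreserving (shiftMap N) μ μ) :
    ∀ᵐ x ∂μ, ∀ (i : ℤ) (q n₀ : ℕ), ∃ n ≥ n₀, ∀ k < q,
      x (edgeLevel (i - n + k)) = x (edgeLevel (i + k)) := by
  rw [MeasureTheory.ae_all_iff]
  intro i
  rw [MeasureTheory.ae_all_iff]
  intro q
  -- Poincaré recurrence for a cylinder; finitely many words `u` occur for given `i` and `q`, so the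
  -- null sets can be combined.
  have hcyl : ∀ u : Fin q → Fin N, ∀ᵐ x ∂μ, x ∈ {x : FullShift N | ∀ k : Fin q,
      x (edgeLevel (i + k)) = u k} → ∃ᶠ n in Filter.atTop, (shiftMap N)^[n] x ∈
      {x : FullShift N | ∀ k : Fin q, x (edgeLevel (i + k)) = u k} := by
    intro u
    refine hμ.conservative.ae_mem_imp_frequently_image_mem (MeasurableSet.nullMeasurableSet ?_)
    rw [ofPred_forall]
    exact MeasurableSet.iInter fun k =>
      measurableSet_eq_fun (measurable_pi_apply _) measurable_const
  filter_upwards [MeasureTheory.ae_all_iff.2 hcyl] with x hx n₀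
  obtain ⟨n, hn, h⟩ := Filter.frequently_atTop.1
    (hx (fun k => x (edgeLevel (i + k))) fun k => rfl) n₀
  refine ⟨n, hn, fun k hk => ?_⟩
  have := h ⟨k, hk⟩
  rw [shiftMap_iterate_edgeLevel] at this
  rw [← this]
  congr 2
  ring

/-! ### Subtiles -/

/-- The homeomorphism `z ↦ a • z + u`. -/
def affineHomeo {d : ℕ} {a : ℝ} (ha : a ≠ 0) (u : Space d) : Space d ≃ₜ Space d :=
  (Homeomorph.smulOfNeZero a ha).trans (Homeomorph.addRight u)

theorem MeetAlongBoundary.disjoint_interior {d : ℕ} {A B : Set (Space d)}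
    (h : MeetAlongBoundary A B) : Disjoint (interior A) B := by
  rw [Set.disjoint_left]
  intro z hz hz'
  exact (h ⟨interior_subset hz, hz'⟩).1.2 hz

/-- The product of the first `n` contraction constants along a word. -/
def wordScale {N : ℕ} (θ : Fin N → ℝ) (w : ℕ → Fin N) (n : ℕ) : ℝ :=
  ∏ i ∈ Finset.range n, θ (w i)

@[simp] theorem wordScale_zero {N : ℕ} (θ : Fin N → ℝ) (w : ℕ → Fin N) :
    wordScale θ w 0 = 1 := by simp [wordScale]

theorem wordScale_succ {N : ℕ} (θ : Fin N → ℝ) (w : ℕ → Fin N) (n : ℕ) :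
    wordScale θ w (n + 1) = wordScale θ w n * θ (w n) := Finset.prod_range_succ _ _

theorem wordScale_pos {N : ℕ} {θ : Fin N → ℝ} (hθ : ∀ l, 0 < θ l) (w : ℕ → Fin N) (n : ℕ) :
    0 < wordScale θ w n := Finset.prod_pos fun _ _ => hθ _

variable {d M N : ℕ} {t : Fin M → Set (Space d)} {S : Fin N → SubstitutionRule t}
  {θ : Fin N → ℝ}

theorem Path.map_eq (hθ : ∀ l, (S l).IsUniformlyExpanding (θ l)) {w : ℕ → Fin N} {n : ℕ}
    {v : Fin M} (p : Path S w n v) (z : Space d) :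
    p.map z = wordScale θ w n • z + p.map 0 := by
  induction p with
  | nil v => simp [Path.map]
  | @snoc n u p v k ih =>
    simp only [Path.map, Function.comp_apply, SubstitutionRule.f]
    rw [ih, (hθ _).2.2, wordScale_succ]
    module

/-- Add an edge at the beginning of a path. -/
theorem Path.exists_cons {w : ℕ → Fin N} {n : ℕ} {v : Fin M}
    (p : Path S (fun i => w (i + 1)) n v) {j : Fin M} (k : Fin ((S (w 0)).κ p.source j)) :
    ∃ q : Path S w (n + 1) v, q.source = j ∧
      ∀ z, q.map z = p.map ((S (w 0)).f p.source j k z) := by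
  induction p with
  | nil v => exact ⟨.snoc (.nil j) v k, rfl, fun z => rfl⟩
  | @snoc n u p v k' ih =>
    obtain ⟨q, hq, hmap⟩ := ih k
    refine ⟨.snoc q v k', hq, fun z => ?_⟩
    simp only [Path.map, Function.comp_apply, hmap]
    rfl

/-- A path with at least one edge has a first edge. -/
theorem Path.exists_first_edge {w : ℕ → Fin N} {n : ℕ} {v : Fin M} (p : Path S w n v)
    (hn : 0 < n) : ∃ i, Nonempty (Fin ((S (w 0)).κ i p.source)) := by
  induction p with
  | nil v => exact absurd hn (lt_irrefl _)
  | @snoc n u p v k ih =>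
    rcases Nat.eq_zero_or_pos n with rfl | h
    · cases p
      exact ⟨v, ⟨k⟩⟩
    · exact ih h

/-- `Subtile S θ y v n j τ`: refining `t v` by the rules `S (y 0), …, S (y (n - 1))`, in this
order, one of the tiles obtained is `P • t j + τ`, where `P` is the product of the contraction
constants. -/
inductive Subtile (S : Fin N → SubstitutionRule t) (θ : Fin N → ℝ) (y : ℕ → Fin N)
    (v : Fin M) : ℕ → Fin M → Space d → Prop
  | zero : Subtile S θ y v 0 v 0
  | succ {n : ℕ} {u : Fin M} {τ : Space d} (h : Subtile S θ y v n u τ) {l : Fin N}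
      (hl : y n = l) (j : Fin M) (k : Fin ((S l).κ u j)) :
      Subtile S θ y v (n + 1) j (wordScale θ y n • (S l).shift u j k + τ)

/-- The set `a • A + τ`. -/
def scaledSet (a : ℝ) (τ : Space d) (A : Set (Space d)) : Set (Space d) :=
  (fun z => a • z + τ) '' A

theorem interior_scaledSet {a : ℝ} (ha : a ≠ 0) (τ : Space d) (A : Set (Space d)) :
    interior (scaledSet a τ A) = scaledSet a τ (interior A) :=
  ((affineHomeo ha τ).image_interior A).symm

theorem scaledSet_succ (hθ : ∀ l, (S l).IsUniformlyExpanding (θ l)) {y : ℕ → Fin N} {n : ℕ}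
    {l : Fin N} (hl : y n = l) (u j : Fin M) (k : Fin ((S l).κ u j)) (τ : Space d)
    (A : Set (Space d)) :
    scaledSet (wordScale θ y (n + 1)) (wordScale θ y n • (S l).shift u j k + τ) A =
      scaledSet (wordScale θ y n) τ ((S l).f u j k '' A) := by
  unfold scaledSet
  rw [image_image]
  congr 1
  funext z
  rw [wordScale_succ, hl, SubstitutionRule.f, (hθ l).2.2]
  module

theorem SubstitutionRule.image_subset (R : SubstitutionRule t) (i j : Fin M)
    (k : Fin (R.κ i j)) : R.f i j k '' t j ⊆ t i := by
  intro z hz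
  rw [R.union_eq i]
  exact mem_iUnion.2 ⟨j, mem_iUnion.2 ⟨k, hz⟩⟩

theorem SubstitutionRule.exists_mem_image (R : SubstitutionRule t) {i : Fin M} {z : Space d}
    (hz : z ∈ t i) : ∃ j, ∃ k : Fin (R.κ i j), z ∈ R.f i j k '' t j := by
  rw [R.union_eq i] at hz
  simp only [mem_iUnion] at hz
  exact hz

theorem Subtile.exists_mem (hθ : ∀ l, (S l).IsUniformlyExpanding (θ l)) (y : ℕ → Fin N)
    {v : Fin M} {z : Space d} (hz : z ∈ t v) (n : ℕ) :
    ∃ j τ, Subtile S θ y v n j τ ∧ z ∈ scaledSet (wordScale θ y n) τ (t j) := by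
  induction n with
  | zero => exact ⟨v, 0, .zero, z, hz, by simp⟩
  | succ n ih =>
    obtain ⟨u, τ, h, x, hx, rfl⟩ := ih
    obtain ⟨j, k, hk⟩ := (S (y n)).exists_mem_image hx
    refine ⟨j, _, h.succ rfl j k, ?_⟩
    rw [scaledSet_succ hθ rfl]
    exact ⟨x, hk, rfl⟩

theorem Subtile.disjoint_interior (hθ : ∀ l, (S l).IsUniformlyExpanding (θ l))
    {y : ℕ → Fin N} {v : Fin M} {n : ℕ} {j : Fin M} {τ : Space d} (h : Subtile S θ y v n j τ) :
    ∀ {j' : Fin M} {τ' : Space d}, Subtile S θ y v n j' τ' → (j, τ) ≠ (j', τ') →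
      Disjoint (interior (scaledSet (wordScale θ y n) τ (t j)))
        (scaledSet (wordScale θ y n) τ' (t j')) := by
  have hpos := fun n => (wordScale_pos (fun l => (hθ l).1) y n).ne'
  induction h with
  | zero =>
    intro j' τ' h' hne
    cases h'
    exact absurd rfl hne
  | @succ n u τ h l hl j k ih =>
    intro j' τ' h' hne
    cases h' with
    | @succ _ u' τ' h' l' hl' _ k' =>
    subst hl
    subst hl'
    rw [scaledSet_succ hθ rfl, scaledSet_succ hθ rfl]
    -- Siblings are separated by the boundary condition of the rule, tiles with different parents by
    -- induction.
    by_cases hpar : (u, τ) = (u', τ')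
    · obtain ⟨rfl, rfl⟩ := Prod.mk.inj hpar
      rw [interior_scaledSet (hpos n)]
      refine (Set.disjoint_image_iff (affineHomeo (hpos n) τ).injective).2 ?_
      refine ((S (y n)).boundary u ⟨j, k⟩ ⟨j', k'⟩ ?_).disjoint_interior
      intro heq
      obtain ⟨rfl, hk⟩ := Sigma.mk.inj heq
      exact hne (by rw [eq_of_heq hk])
    · exact (ih h' hpar).mono (interior_mono (image_mono ((S (y n)).image_subset _ _ _)))
        (image_mono ((S (y n)).image_subset _ _ _))

/-- The subtiles of a prototile come from paths that end at its vertex. -/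
theorem Subtile.exists_path (hθ : ∀ l, (S l).IsUniformlyExpanding (θ l)) {y : ℕ → Fin N}
    {v : Fin M} {n : ℕ} {j : Fin M} {τ : Space d} (h : Subtile S θ y v n j τ) :
    ∀ w : ℕ → Fin N, (∀ i < n, w i = y (n - 1 - i)) →
      ∃ p : Path S w n v, p.source = j ∧ ∀ z, p.map z = wordScale θ y n • z + τ := by
  induction h with
  | zero => exact fun w _ => ⟨.nil v, rfl, fun z => by simp [Path.map]⟩
  | @succ n u τ h l hl j k ih =>
    intro w hw
    -- Refinement goes down and paths go up: the last rule applied supplies the first edge, so `w`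
    -- is `y` reversed.
    obtain ⟨p, rfl, hp⟩ := ih (fun i => w (i + 1)) fun i hi => by
      rw [hw (i + 1) (by omega)]; congr 1; omega
    have hl' : w 0 = l := by rw [hw 0 (by omega), ← hl]; congr 1
    subst hl'
    obtain ⟨q, hq, hmap⟩ := p.exists_cons k
    refine ⟨q, hq, fun z => ?_⟩
    rw [hmap, hp, SubstitutionRule.f, (hθ _).2.2, wordScale_succ, hl]
    module

/-- A path that reads the symbols of `y` refines a subtile. -/
theorem Subtile.descend (hθ : ∀ l, (S l).IsUniformlyExpanding (θ l)) {y : ℕ → Fin N}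
    {v : Fin M} {w : ℕ → Fin N} {q : ℕ} {j : Fin M} (p : Path S w q j) :
    ∀ {m : ℕ} {τ : Space d}, (∀ i < q, w i = y (m + q - 1 - i)) → Subtile S θ y v m j τ →
      ∃ τ', Subtile S θ y v (m + q) p.source τ' ∧
        scaledSet (wordScale θ y (m + q)) τ' (t p.source) ⊆
          scaledSet (wordScale θ y m) τ (t j) := by
  induction p with
  | nil v => exact fun _ h => ⟨_, h, subset_rfl⟩
  | @snoc q u p j k ih =>
    intro m τ hw h
    have hl : y m = w q := by rw [hw q (by omega)]; congr 1; omega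
    obtain ⟨τ', h', hsub⟩ := ih (m := m + 1) (fun i hi => by
      rw [hw i (by omega)]; congr 1; omega) (h.succ hl u k)
    rw [show m + (q + 1) = m + 1 + q by omega]
    refine ⟨τ', h', hsub.trans ?_⟩
    rw [scaledSet_succ hθ hl]
    exact image_mono ((S (w q)).image_subset _ _ _)

/-! ### Infinite paths -/

theorem exists_sequence_through {α : Type*} (R : ℕ → α → α → Prop)
    (hup : ∀ i a, ∃ b, R i a b) (hdown : ∀ i b, ∃ a, R i a b) (n : ℕ) (v : α) :
    ∃ V : ℕ → α, V n = v ∧ ∀ i, R i (V i) (V (i + 1)) := by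
  induction n generalizing R v with
  | zero =>
    choose f hf using hup
    exact ⟨fun n => Nat.rec v (fun i a => f i a) n, rfl, fun i => hf i _⟩
  | succ n ih =>
    obtain ⟨V, hV, hR⟩ := ih (fun i => R (i + 1)) (fun i => hup (i + 1))
      (fun i => hdown (i + 1)) v
    obtain ⟨a, ha⟩ := hdown 0 (V 0)
    refine ⟨fun i => Nat.casesOn i a V, hV, fun i => ?_⟩
    cases i with
    | zero => exact ha
    | succ i => exact hR i

/-- Compatibility concerns approximants of infinite paths, so a finite path must be embedded in one.
Edges downwards exist because every prototile is covered by its subtiles. -/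
theorem exists_infPath_through (hne : ∀ i, (t i).Nonempty) (w : ℕ → Fin N)
    (hup : ∀ i u, ∃ v, Nonempty (Fin ((S (w i)).κ v u))) (n : ℕ) (v : Fin M) :
    ∃ e : InfPath S w, e.vertex n = v := by
  obtain ⟨V, hV, hR⟩ := exists_sequence_through
    (fun i u v => Nonempty (Fin ((S (w i)).κ v u))) hup (fun i b => by
      obtain ⟨z, hz⟩ := hne b
      obtain ⟨j, k, -⟩ := (S (w i)).exists_mem_image hz
      exact ⟨j, ⟨k⟩⟩) n v
  exact ⟨⟨V, fun i => (hR i).some⟩, hV⟩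

/-! ### Finitely many displacements of neighbouring tiles -/

/-- Otherwise `B` would be invariant under the nonzero translation `u - u'`, hence unbounded. -/
theorem shiftSet_injective_of_isBounded {B : Set (Space d)} (hne : B.Nonempty)
    (hB : Bornology.IsBounded B) {u u' : Space d} (h : shiftSet u B = shiftSet u' B) :
    u = u' := by
  obtain ⟨r, hr⟩ := hB.exists_norm_le
  obtain ⟨b, hb⟩ := hne
  have hstep : ∀ z ∈ B, z + (u - u') ∈ B := by
    intro z hz
    have : z + u ∈ shiftSet u' B := h ▸ ⟨z, hz, rfl⟩
    obtain ⟨z', hz', heq⟩ := this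
    have : z + (u - u') = z' := by
      have heq : z' + u' = z + u := heq
      rw [← add_sub_assoc, ← heq, add_sub_cancel_right]
    exact this ▸ hz'
  have hiter : ∀ n : ℕ, b + n • (u - u') ∈ B := by
    intro n
    induction n with
    | zero => simpa using hb
    | succ n ih => rw [succ_nsmul, ← add_assoc]; exact hstep _ ih
  by_contra hne
  have hpos : 0 < ‖u - u'‖ := norm_pos_iff.2 (sub_ne_zero.2 hne)
  obtain ⟨n, hn⟩ := exists_nat_gt ((r + ‖b‖) / ‖u - u'‖)
  rw [div_lt_iff₀ hpos] at hn
  have h1 := hr _ (hiter n)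
  have h2 : ‖n • (u - u')‖ ≤ ‖b + n • (u - u')‖ + ‖b‖ := by
    have := norm_sub_le (b + n • (u - u')) b
    rwa [add_sub_cancel_left] at this
  rw [← Nat.cast_smul_eq_nsmul ℝ, norm_smul, Real.norm_natCast] at h2
  rw [← Nat.cast_smul_eq_nsmul ℝ] at h1
  linarith

/-- This makes compatibility available for words read from a negative level. -/
theorem exists_positivePart_eq (w : ℕ → Fin N) : ∃ x : FullShift N, positivePart x = w := by
  refine ⟨fun m => w (m.1.toNat - 1), ?_⟩
  funext n
  simp only [positivePart, fromLevel, edgeLevel]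
  congr 1
  simp

/-- Paths of equal length along `w` contract by the same factor, so the factors cancel and a
translation remains. -/
theorem placed_eq (hθ : ∀ l, (S l).IsUniformlyExpanding (θ l)) {w : ℕ → Fin N}
    (e : InfPath S w) {n : ℕ} (p : Path S w n (e.vertex n)) (A : Set (Space d)) :
    placed e p A =
      shiftSet ((wordScale θ w n)⁻¹ • (p.map 0 - (e.trunc n).map 0)) A := by
  have hpos := (wordScale_pos (fun l => (hθ l).1) w n).ne'
  ext z
  simp only [placed, shiftSet, mem_preimage, mem_image]
  refine exists_congr fun x => and_congr_right fun _ => ?_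
  rw [p.map_eq hθ, (e.trunc n).map_eq hθ z]
  rw [← (smul_right_injective (Space d) hpos).eq_iff (a := x + _)]
  simp only [smul_add, smul_inv_smul₀ hpos]
  rw [← add_sub_assoc, sub_eq_iff_eq_add]

/-- Finite local complexity: if two distinct tiles meet, the normalised displacement translates a
nonempty union of cells `B` of one prototile onto a union of cells `A` of another. There are
finitely many pairs `(A, B)`, and each admits at most one translation. The value `0` accounts for `p
= q`. -/
theorem exists_finite_displacements (ht : ∀ i, IsCompact (t i))
    (hθ : ∀ l, (S l).IsUniformlyExpanding (θ l)) (hS : Compatible S) :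
    ∃ F : Set (Space d), F.Finite ∧ ∀ (w : ℕ → Fin N) (e : InfPath S w) (n : ℕ)
      (p q : Path S w n (e.vertex n)),
      (p.map '' t p.source ∩ q.map '' t q.source).Nonempty →
      (wordScale θ w n)⁻¹ • (q.map 0 - p.map 0) ∈ F := by
  obtain ⟨cw, hcw⟩ := hS
  let U : Fin M → Set (Set (Space d)) := fun i => {A | @IsUnionOfCells _ _ (t i) (cw i) A}
  have hU : ∀ i, (U i).Finite := fun i => @finite_unionsOfCells _ _ _ (t i) (cw i) (ht i)
  refine ⟨insert 0 (⋃ i, ⋃ j, ⋃ A ∈ U i, ⋃ B ∈ U j, {u | A.Nonempty ∧ shiftSet u B = A}),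
    Finite.insert _ (finite_iUnion fun i => finite_iUnion fun j => (hU i).biUnion fun A _ =>
      (hU j).biUnion fun B hB => Set.Subsingleton.finite ?_), ?_⟩
  · rintro u ⟨hA, hu⟩ u' ⟨-, hu'⟩
    refine shiftSet_injective_of_isBounded (B := B) ?_ ?_ (hu.trans hu'.symm)
    · rw [← hu] at hA
      exact image_nonempty.1 hA
    · exact (ht j).isBounded.subset (@IsUnionOfCells.subset _ _ _ _ (cw j) hB)
  · intro w e n p q hne
    by_cases hpq : p = q
    · left; rw [hpq]; simp
    right
    have hpos := (wordScale_pos (fun l => (hθ l).1) w n).ne'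
    obtain ⟨x, rfl⟩ := exists_positivePart_eq w
    obtain ⟨A, B, hA, hB, h1, h2⟩ := hcw x e n p q hpq
    simp only [mem_iUnion]
    refine ⟨p.source, q.source, A, hA, B, hB, ?_, ?_⟩
    · obtain ⟨z, hz⟩ := hne
      have : (placed e p (t p.source) ∩ placed e q (t q.source)).Nonempty := by
        refine ⟨(wordScale θ (positivePart x) n)⁻¹ • (z - (e.trunc n).map 0), ?_⟩
        have : (e.trunc n).map
            ((wordScale θ (positivePart x) n)⁻¹ • (z - (e.trunc n).map 0)) = z := by
          rw [(e.trunc n).map_eq hθ, smul_inv_smul₀ hpos, sub_add_cancel]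
        simpa only [placed, mem_inter_iff, mem_preimage, this] using hz
      rw [h1] at this
      rw [placed_eq hθ] at this
      exact image_nonempty.1 this
    · rw [h1, placed_eq hθ, placed_eq hθ] at h2
      have h3 := congrArg (shiftSet (-((wordScale θ (positivePart x) n)⁻¹ •
        (p.map 0 - (e.trunc n).map 0)))) h2
      simp only [shiftSet, image_image, add_neg_cancel_right, image_id'] at h3
      rw [h3, shiftSet]
      refine image_congr fun z _ => ?_
      module

/-! ### Rigidity -/

theorem exists_scale_bounds (hθ : ∀ l, (S l).IsUniformlyExpanding (θ l)) :
    ∃ a b : ℝ, 0 < a ∧ 0 < b ∧ b < 1 ∧ ∀ l, a ≤ θ l ∧ θ l ≤ b := by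
  rcases isEmpty_or_nonempty (Fin N) with h | h
  · exact ⟨1 / 2, 1 / 2, by norm_num, by norm_num, by norm_num, fun l => h.elim l⟩
  · obtain ⟨i, hi⟩ := Finite.exists_min θ
    obtain ⟨j, hj⟩ := Finite.exists_max θ
    exact ⟨θ i, θ j, (hθ i).1, (hθ j).1, (hθ j).2.1, fun l => ⟨hi l, hj l⟩⟩

theorem exists_wordScale_lt (hθ : ∀ l, (S l).IsUniformlyExpanding (θ l)) (y : ℕ → Fin N)
    {ε : ℝ} (hε : 0 < ε) : ∃ n₀, ∀ n ≥ n₀, wordScale θ y n < ε := by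
  obtain ⟨a, b, ha, hb, hb1, hab⟩ := exists_scale_bounds hθ
  obtain ⟨n₀, hn₀⟩ := exists_pow_lt_of_lt_one hε hb1
  refine ⟨n₀, fun n hn => lt_of_le_of_lt ?_ hn₀⟩
  calc wordScale θ y n ≤ ∏ _i ∈ Finset.range n, b :=
        Finset.prod_le_prod (fun i _ => (hθ _).1.le) fun i _ => (hab _).2
    _ = b ^ n := by simp
    _ ≤ b ^ n₀ := pow_le_pow_of_le_one hb.le hb1.le hn

theorem map_wordScale_smul (L : Space d →+ ℝ) (hL : ∀ l h, L (θ l • h) = θ l * L h)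
    (y : ℕ → Fin N) (n : ℕ) (h : Space d) :
    L (wordScale θ y n • h) = wordScale θ y n * L h := by
  induction n generalizing h with
  | zero => simp
  | succ n ih => rw [wordScale_succ, mul_smul, ih, hL, mul_assoc]

/-! ### Control points at all scales and the differentiation argument. -/

/-- The control points of all subtiles of `t v`. -/
def controlSet (S : Fin N → SubstitutionRule t) (θ : Fin N → ℝ) (c : Fin M → Space d)
    (y : ℕ → Fin N) (v : Fin M) : Set (Space d) :=
  {a | ∃ n j τ, Subtile S θ y v n j τ ∧ a = wordScale θ y n • c j + τ}

/-- With `P_m` the scale of level `m`, climbing from level `m + 1` to `m` changes `L` by at most `C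
* P_m`, which is at most `C / (1 - b) * (P_m - P_{m+1})`; this form telescopes. -/
theorem Subtile.exists_ancestor (hθ : ∀ l, (S l).IsUniformlyExpanding (θ l))
    {c : Fin M → Space d} (L : Space d →+ ℝ) (hL : ∀ l h, L (θ l • h) = θ l * L h)
    {C b : ℝ} (hC : ∀ l i j (k : Fin ((S l).κ i j)), |L ((S l).f i j k (c j) - c i)| ≤ C)
    (hb : ∀ l, θ l ≤ b) (hb1 : b < 1) {y : ℕ → Fin N} {v : Fin M} {m : ℕ} {j : Fin M}
    {τ : Space d} (h : Subtile S θ y v m j τ) : ∀ n ≤ m, ∃ j' τ', Subtile S θ y v n j' τ' ∧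
      scaledSet (wordScale θ y m) τ (t j) ⊆ scaledSet (wordScale θ y n) τ' (t j') ∧
      |L (wordScale θ y m • c j + τ - (wordScale θ y n • c j' + τ'))| ≤
        C / (1 - b) * (wordScale θ y n - wordScale θ y m) := by
  induction h with
  | zero =>
    intro n hn
    obtain rfl : n = 0 := by omega
    exact ⟨v, 0, .zero, subset_rfl, by simp⟩
  | @succ m u τ h l hl j k ih =>
    intro n hn
    rcases Nat.lt_succ_iff_lt_or_eq.1 (Nat.lt_succ_of_le hn) with hn | rfl
    · obtain ⟨j', τ', h', hsub, hbd⟩ := ih n (by omega)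
      refine ⟨j', τ', h', ?_, ?_⟩
      · rw [scaledSet_succ hθ hl]
        exact (image_mono ((S l).image_subset _ _ _)).trans hsub
      · have hP := wordScale_pos (fun l => (hθ l).1) y m
        have heq : wordScale θ y (m + 1) • c j + (wordScale θ y m • (S l).shift u j k + τ) -
            (wordScale θ y n • c j' + τ') = wordScale θ y m • ((S l).f u j k (c j) - c u) +
            (wordScale θ y m • c u + τ - (wordScale θ y n • c j' + τ')) := by
          rw [wordScale_succ, hl, SubstitutionRule.f, (hθ l).2.2]
          module
        rw [heq, map_add, map_wordScale_smul L hL]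
        refine (abs_add_le _ _).trans ?_
        rw [abs_mul, abs_of_pos hP]
        have h1 := mul_le_mul_of_nonneg_left (hC l u j k) hP.le
        have hC0 : 0 ≤ C := (abs_nonneg _).trans (hC l u j k)
        have h2 : wordScale θ y m * C ≤
            C / (1 - b) * (wordScale θ y m - wordScale θ y (m + 1)) := by
          rw [wordScale_succ, hl, div_mul_eq_mul_div, le_div_iff₀ (by linarith)]
          have := mul_le_mul_of_nonneg_left (hb l) (mul_nonneg hP.le hC0)
          nlinarith
        linarith
    · exact ⟨j, _, h.succ hl j k, subset_rfl, by simp⟩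

/-- A control point of a tile remains a control point at every finer level, by the choice of control
points. -/
theorem Subtile.exists_descendant (hθ : ∀ l, (S l).IsUniformlyExpanding (θ l))
    {c : Fin M → Space d}
    (hsub : ∀ l i, ∃ j, ∃ k : Fin ((S l).κ i j), (S l).f i j k (c j) = c i)
    {y : ℕ → Fin N} {v : Fin M} {m : ℕ} {j : Fin M} {τ : Space d}
    (h : Subtile S θ y v m j τ) (n : ℕ) : ∃ j' τ', Subtile S θ y v (m + n) j' τ' ∧
      wordScale θ y m • c j + τ = wordScale θ y (m + n) • c j' + τ' := by
  induction n with
  | zero => exact ⟨j, τ, h, rfl⟩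
  | succ n ih =>
    obtain ⟨i, τ', h', heq⟩ := ih
    obtain ⟨j', k, hk⟩ := hsub (y (m + n)) i
    refine ⟨j', _, h'.succ rfl j' k, ?_⟩
    rw [heq, ← hk, ← add_assoc m n 1, wordScale_succ, SubstitutionRule.f, (hθ _).2.2]
    module

/-- Every control point is close to the control point of a tile of any level containing it. -/
theorem controlSet.exists_subtile (hθ : ∀ l, (S l).IsUniformlyExpanding (θ l))
    {c : Fin M → Space d} (hc : ∀ i, c i ∈ t i)
    (hsub : ∀ l i, ∃ j, ∃ k : Fin ((S l).κ i j), (S l).f i j k (c j) = c i)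
    (L : Space d →+ ℝ) (hL : ∀ l h, L (θ l • h) = θ l * L h) :
    ∃ C : ℝ, 0 ≤ C ∧ ∀ (y : ℕ → Fin N) (v : Fin M), ∀ a ∈ controlSet S θ c y v, ∀ n,
      ∃ j τ, Subtile S θ y v n j τ ∧ a ∈ scaledSet (wordScale θ y n) τ (t j) ∧
        |L (a - (wordScale θ y n • c j + τ))| ≤ C * wordScale θ y n := by
  obtain ⟨a, b, ha, hb, hb1, hab⟩ := exists_scale_bounds hθ
  obtain ⟨C, hC⟩ := (Set.finite_range
    fun e : Σ l, Σ i, Σ j, Fin ((S l).κ i j) =>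
      |L ((S e.1).f e.2.1 e.2.2.1 e.2.2.2 (c e.2.2.1) - c e.2.1)|).bddAbove
  have hC' : ∀ l i j (k : Fin ((S l).κ i j)),
      |L ((S l).f i j k (c j) - c i)| ≤ max C 0 := fun l i j k =>
    (hC ⟨⟨l, i, j, k⟩, rfl⟩).trans (le_max_left _ _)
  have hC1 : 0 ≤ max C 0 / (1 - b) := div_nonneg (le_max_right _ _) (by linarith)
  refine ⟨max C 0 / (1 - b), hC1, ?_⟩
  rintro y v _ ⟨m, j, τ, h, rfl⟩ n
  have hP := fun n => wordScale_pos (fun l => (hθ l).1) y n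
  rcases le_total n m with hnm | hnm
  · obtain ⟨j', τ', h', hsub', hbd⟩ :=
      h.exists_ancestor hθ L hL hC' (fun l => (hab l).2) hb1 n hnm
    refine ⟨j', τ', h', hsub' ⟨c j, hc j, rfl⟩, hbd.trans ?_⟩
    exact mul_le_mul_of_nonneg_left (by linarith [hP m]) hC1
  · obtain ⟨k, rfl⟩ := Nat.exists_eq_add_of_le hnm
    obtain ⟨j', τ', h', heq⟩ := h.exists_descendant hθ hsub k
    refine ⟨j', τ', h', heq ▸ ⟨c j', hc j', rfl⟩, ?_⟩
    rw [heq, sub_self, map_zero, abs_zero]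
    exact mul_nonneg hC1 (hP _).le

/-- A functional that is bounded on the displacements of neighbouring tiles is Lipschitz on the
control points in a ball. -/
theorem exists_lipschitz_bound (hθ : ∀ l, (S l).IsUniformlyExpanding (θ l))
    (ht : ∀ i, IsCompact (t i)) (ht' : ∀ i, (interior (t i)).Nonempty)
    {c : Fin M → Space d} (hc : ∀ i, c i ∈ t i)
    (hsub : ∀ l i, ∃ j, ∃ k : Fin ((S l).κ i j), (S l).f i j k (c j) = c i)
    (L : Space d →+ ℝ) (hL : ∀ l h, L (θ l • h) = θ l * L h)
    (y : ℕ → Fin N) (v : Fin M) {C : ℝ} (hC0 : 0 ≤ C)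
    (hadj : ∀ n j τ j' τ', Subtile S θ y v n j τ → Subtile S θ y v n j' τ' →
      (scaledSet (wordScale θ y n) τ (t j) ∩ scaledSet (wordScale θ y n) τ' (t j')).Nonempty →
      |L (wordScale θ y n • c j + τ - (wordScale θ y n • c j' + τ'))| ≤ C * wordScale θ y n)
    {z : Space d} {r : ℝ} (hball : Metric.ball z r ⊆ t v) :
    ∃ K : NNReal, LipschitzOnWith K L (controlSet S θ c y v ∩ Metric.ball z r) := by
  obtain ⟨α, β, hα, hβ, hβ1, hαβ⟩ := exists_scale_bounds hθ
  obtain ⟨C₂, hC₂, hnear⟩ := controlSet.exists_subtile hθ hc hsub L hL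
  have hP := fun n => wordScale_pos (fun l => (hθ l).1) y n
  choose o ho using ht'
  have hρ' : ∀ j, ∃ ρ > 0, Metric.ball (o j) ρ ⊆ t j := fun j =>
    Metric.mem_nhds_iff.1 (mem_interior_iff_mem_nhds.1 (ho j))
  choose ρ' hρ'0 hρ' using hρ'
  have : Nonempty (Fin M) := ⟨v⟩
  obtain ⟨jm, hjm⟩ := Finite.exists_min ρ'
  set ρ := ρ' jm with hρdef
  have hρ0 : 0 < ρ := hρ'0 jm
  have hρ : ∀ j, Metric.ball (o j) ρ ⊆ t j := fun j =>
    (Metric.ball_subset_ball (hjm j)).trans (hρ' j)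
  obtain ⟨Δ, hΔ⟩ := (isCompact_iUnion ht).isBounded.exists_norm_le
  have hΔ' : ∀ j, ∀ w ∈ t j, ‖w‖ ≤ Δ := fun j w hw => hΔ w (mem_iUnion.2 ⟨j, hw⟩)
  -- Below, `n` is the first level whose scale is at most `dist a b`. If `n = 0`, the distance is at
  -- most `2 * r`; otherwise it is less than the previous scale, which exceeds the current one by a
  -- factor of at most `α⁻¹`.
  set Q := max (2 * r) α⁻¹ with hQdef
  obtain ⟨m, hm⟩ := exists_packing_bound (0 : Space d) (2 * Δ + Q) hρ0
  have hbound : ∀ a ∈ controlSet S θ c y v ∩ Metric.ball z r,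
      ∀ b ∈ controlSet S θ c y v ∩ Metric.ball z r,
      |L a - L b| ≤ (2 * C₂ + m * C) * dist a b := by
    rintro a ⟨haZ, haB⟩ b ⟨hbZ, hbB⟩
    by_cases hab : a = b
    · simp [hab]
    have hdist : 0 < dist a b := dist_pos.2 hab
    obtain ⟨n, hn1, hn2⟩ : ∃ n, wordScale θ y n ≤ dist a b ∧
        dist a b ≤ Q * wordScale θ y n := by
      classical
      have hex : ∃ n, wordScale θ y n ≤ dist a b := by
        obtain ⟨n₀, hn₀⟩ := exists_wordScale_lt hθ y hdist
        exact ⟨n₀, (hn₀ n₀ le_rfl).le⟩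
      refine ⟨Nat.find hex, Nat.find_spec hex, ?_⟩
      rcases Nat.eq_zero_or_pos (Nat.find hex) with h0 | h0
      · rw [h0, wordScale_zero, mul_one]
        have h1 := dist_triangle_right a b z
        rw [Metric.mem_ball] at haB hbB
        exact le_trans (by linarith) (le_max_left _ _)
      · obtain ⟨n, hn⟩ := Nat.exists_eq_succ_of_ne_zero h0.ne'
        have h1 : dist a b < wordScale θ y n := not_le.1 (Nat.find_min hex (by omega))
        rw [hn, Nat.succ_eq_add_one, wordScale_succ]
        have h2 : wordScale θ y n * α ≤ wordScale θ y n * θ (y n) :=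
          mul_le_mul_of_nonneg_left (hαβ _).1 (hP n).le
        have h3 : dist a b ≤ α⁻¹ * (wordScale θ y n * α) := by
          rw [mul_comm (wordScale θ y n), inv_mul_cancel_left₀ hα.ne']; exact h1.le
        refine h3.trans (mul_le_mul (le_max_right _ _) h2 (by have := hP n; positivity) ?_)
        exact (inv_nonneg.2 hα.le).trans (le_max_right _ _)
    obtain ⟨ja, τa, hsa, hmema, hLa⟩ := hnear y v a haZ n
    obtain ⟨jb, τb, hsb, hmemb, hLb⟩ := hnear y v b hbZ n
    -- The level-`n` tiles that meet the segment. Rescaled by the inverse scale about `a`, their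
    -- marked interior points lie in a fixed ball and are `ρ`-separated, so at most `m` tiles occur
    -- whatever `n` is.
    let ι := {x : Fin M × Space d // Subtile S θ y v n x.1 x.2 ∧
      (segment ℝ a b ∩ scaledSet (wordScale θ y n) x.2 (t x.1)).Nonempty}
    have hcard : Finite ι ∧ Nat.card ι ≤ m := by
      refine hm ι (fun x => o x.1.1 + (wordScale θ y n)⁻¹ • (x.1.2 - a)) ?_ ?_
      · rintro ⟨⟨j, τ⟩, hs, x, hxs, w, hw, rfl⟩
        rw [mem_closedBall_zero_iff]
        have h1 : ‖wordScale θ y n • w + τ - a‖ ≤ Q * wordScale θ y n := by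
          rw [← dist_eq_norm]
          have := (convex_closedBall a (dist a b)).segment_subset
            (Metric.mem_closedBall_self dist_nonneg)
            (by rw [Metric.mem_closedBall, dist_comm]) hxs
          rw [Metric.mem_closedBall] at this
          exact this.trans hn2
        have h2 : o j + (wordScale θ y n)⁻¹ • (τ - a) =
            o j - w + (wordScale θ y n)⁻¹ • (wordScale θ y n • w + τ - a) := by
          rw [add_sub_assoc, smul_add, inv_smul_smul₀ (hP n).ne']; abel
        change ‖o j + (wordScale θ y n)⁻¹ • (τ - a)‖ ≤ _
        rw [h2]
        refine (norm_add_le _ _).trans (add_le_add ?_ ?_)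
        · have h3 := hΔ' j (o j) (interior_subset (ho j))
          have h4 := hΔ' j w hw
          linarith [norm_sub_le (o j) w]
        · rw [norm_smul, norm_inv, Real.norm_of_nonneg (hP n).le, inv_mul_le_iff₀ (hP n)]
          linarith
      · rintro ⟨⟨j, τ⟩, hs, _⟩ ⟨⟨j', τ'⟩, hs', _⟩ hne
        -- If they were closer than `ρ`, the marked point of the second tile would lie in the
        -- interior of the first.
        by_contra! hlt
        have hne' : (j, τ) ≠ (j', τ') := fun h => hne (Subtype.ext h)
        have hdisj := hs.disjoint_interior hθ hs' hne'
        rw [interior_scaledSet (hP n).ne'] at hdisj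
        have hx : wordScale θ y n • o j' + τ' ∈
            scaledSet (wordScale θ y n) τ (interior (t j)) := by
          refine ⟨o j' + (wordScale θ y n)⁻¹ • (τ' - τ), ?_, ?_⟩
          · refine interior_maximal (hρ j) Metric.isOpen_ball ?_
            rw [Metric.mem_ball, dist_comm]
            refine lt_of_eq_of_lt ?_ hlt
            simp only [dist_eq_norm]
            congr 1
            module
          · simp only [smul_add, smul_inv_smul₀ (hP n).ne']
            abel
        exact Set.disjoint_left.1 hdisj hx ⟨o j', interior_subset (ho j'), rfl⟩
    have := hcard.1
    have hseg : segment ℝ a b ⊆ t v :=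
      ((convex_ball z r).segment_subset haB hbB).trans hball
    have hchain := abs_sub_le_of_chain (ι := ι) (convex_segment (𝕜 := ℝ) a b).isPreconnected
      (fun x => scaledSet (wordScale θ y n) x.1.2 (t x.1.1))
      (fun x => ((ht _).image (by fun_prop)).isClosed)
      (by
        intro x hx
        obtain ⟨j, τ, hs, hxm⟩ := Subtile.exists_mem (S := S) hθ y (hseg hx) n
        exact mem_iUnion.2 ⟨⟨(j, τ), hs, x, hx, hxm⟩, hxm⟩)
      (fun x => x.2.2)
      (fun x => L (wordScale θ y n • c x.1.1 + x.1.2))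
      (mul_nonneg hC0 (hP n).le)
      (fun x x' hxx => by
        rw [← map_sub]
        exact hadj n _ _ _ _ x.2.1 x'.2.1 hxx)
      ⟨(ja, τa), hsa, a, left_mem_segment ℝ a b, hmema⟩
      ⟨(jb, τb), hsb, b, right_mem_segment ℝ a b, hmemb⟩
    simp only at hchain
    have h4 : (Nat.card ι : ℝ) * (C * wordScale θ y n) ≤ m * (C * wordScale θ y n) :=
      mul_le_mul_of_nonneg_right (by exact_mod_cast hcard.2) (mul_nonneg hC0 (hP n).le)
    have h5 : (2 * C₂ + m * C) * wordScale θ y n ≤ (2 * C₂ + m * C) * dist a b :=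
      mul_le_mul_of_nonneg_left hn1 (by positivity)
    rw [map_sub] at hLa hLb
    rw [abs_le] at hLa hLb hchain ⊢
    constructor <;> linarith
  refine ⟨Real.toNNReal (2 * C₂ + m * C), LipschitzOnWith.of_dist_le_mul fun a ha b hb => ?_⟩
  rw [Real.dist_eq, Real.coe_toNNReal _ (by positivity)]
  exact hbound a ha b hb

/-- A functional that is bounded on the displacements of neighbouring tiles agrees with a linear
functional on the displacements of the control points of those edges that occur, at arbitrarily small scales, in
every tile. -/
theorem exists_linear_of_bounded (hθ : ∀ l, (S l).IsUniformlyExpanding (θ l))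
    (ht : ∀ i, IsCompact (t i)) (ht' : ∀ i, (interior (t i)).Nonempty)
    {c : Fin M → Space d} (hc : ∀ i, c i ∈ t i)
    (hsub : ∀ l i, ∃ j, ∃ k : Fin ((S l).κ i j), (S l).f i j k (c j) = c i)
    (L : Space d →+ ℝ) (hL : ∀ l h, L (θ l • h) = θ l * L h)
    (y : ℕ → Fin N) (v : Fin M) {C : ℝ} (hC0 : 0 ≤ C)
    (hadj : ∀ n j τ j' τ', Subtile S θ y v n j τ → Subtile S θ y v n j' τ' →
      (scaledSet (wordScale θ y n) τ (t j) ∩ scaledSet (wordScale θ y n) τ' (t j')).Nonempty →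
      |L (wordScale θ y n • c j + τ - (wordScale θ y n • c j' + τ'))| ≤ C * wordScale θ y n) :
    ∃ ℓ : Space d →ₗ[ℝ] ℝ, ∀ (l : Fin N) (i j : Fin M) (k : Fin ((S l).κ i j)),
      (∃ q, ∀ n₀, ∃ n ≥ n₀, ∀ s τ, Subtile S θ y v n s τ → ∃ τ',
        Subtile S θ y v (n + q) i τ' ∧ y (n + q) = l ∧
        scaledSet (wordScale θ y (n + q)) τ' (t i) ⊆ scaledSet (wordScale θ y n) τ (t s)) →
      L ((S l).f i j k (c j) - c i) = ℓ ((S l).f i j k (c j) - c i) := by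
  obtain ⟨z, hz⟩ := ht' v
  obtain ⟨r, hr, hball⟩ := Metric.mem_nhds_iff.1 (mem_interior_iff_mem_nhds.1 hz)
  obtain ⟨K, hK⟩ := exists_lipschitz_bound hθ ht ht' hc hsub L hL y v hC0 hadj hball
  obtain ⟨g, hg, hgL⟩ := hK.extend_real
  -- Rademacher's theorem: the points of differentiability of the extension are dense.
  have hdense := MeasureTheory.Measure.dense_of_ae
    (hg.ae_differentiableAt (μ := MeasureTheory.volume))
  obtain ⟨z₁, hdiff, hz₁⟩ := hdense.exists_mem_open Metric.isOpen_ball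
    ⟨z, Metric.mem_ball_self hr⟩
  refine ⟨(fderiv ℝ g z₁).toLinearMap, fun l i j k ⟨q, hq⟩ => ?_⟩
  set δ := (S l).f i j k (c j) - c i with hδ
  set ℓ := fderiv ℝ g z₁ with hℓ
  obtain ⟨α, β, hα, hβ, hβ1, hαβ⟩ := exists_scale_bounds hθ
  obtain ⟨Δ, hΔ⟩ := (isCompact_iUnion ht).isBounded.exists_norm_le
  have hΔ' : ∀ j, ∀ w ∈ t j, ‖w‖ ≤ Δ := fun j w hw => hΔ w (mem_iUnion.2 ⟨j, hw⟩)
  have hΔ0 : 0 ≤ Δ := (norm_nonneg _).trans (hΔ' i _ (hc i))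
  have hP := fun n => wordScale_pos (fun l => (hθ l).1) y n
  have hPq : ∀ q n, α ^ q * wordScale θ y n ≤ wordScale θ y (n + q) := by
    intro q n
    induction q with
    | zero => simp
    | succ q ih =>
      rw [← add_assoc, wordScale_succ, pow_succ]
      have h1 : wordScale θ y (n + q) * α ≤ wordScale θ y (n + q) * θ (y (n + q)) :=
        mul_le_mul_of_nonneg_left (hαβ _).1 (hP _).le
      have h2 := mul_le_mul_of_nonneg_right ih hα.le
      linarith
  suffices h : |L δ - ℓ δ| ≤ 0 from sub_eq_zero.1 (abs_nonpos_iff.1 h)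
  refine le_of_forall_pos_le_add fun ε hε => ?_
  rw [zero_add]
  -- Two points each contribute an error `2 * Δ * η` at scale `n`, while the edge has scale at least
  -- `α ^ q` times that; the summand `1` covers `Δ = 0`.
  set η := ε * α ^ q / (4 * Δ + 1) with hη
  have hη0 : 0 < η := by positivity
  have hev := ((show DifferentiableAt ℝ g z₁ from hdiff).hasFDerivAt.isLittleO.def hη0).and
    (Metric.isOpen_ball.mem_nhds hz₁)
  obtain ⟨ρ, hρ, hev⟩ := Metric.eventually_nhds_iff.1 hev
  obtain ⟨n₀, hn₀⟩ := exists_wordScale_lt hθ y (ε := ρ / (2 * Δ + 1)) (by positivity)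
  obtain ⟨n, hn, hedge⟩ := hq n₀
  obtain ⟨s, τ, hs, w, hw, hwz⟩ :=
    Subtile.exists_mem (S := S) hθ y (hball hz₁) n
  obtain ⟨τ', hs', hl, hsub'⟩ := hedge s τ hs
  have hsmall : wordScale θ y n * (2 * Δ + 1) < ρ := (lt_div_iff₀ (by positivity)).1 (hn₀ n hn)
  have hclose : ∀ x ∈ scaledSet (wordScale θ y n) τ (t s), ‖x - z₁‖ ≤ 2 * Δ * wordScale θ y n := by
    rintro _ ⟨w', hw', rfl⟩
    rw [← hwz]
    have : wordScale θ y n • w' + τ - (wordScale θ y n • w + τ) =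
        wordScale θ y n • (w' - w) := by module
    change ‖wordScale θ y n • w' + τ - (wordScale θ y n • w + τ)‖ ≤ _
    rw [this, norm_smul, Real.norm_of_nonneg (hP n).le, mul_comm]
    refine mul_le_mul_of_nonneg_right ?_ (hP n).le
    linarith [norm_sub_le w' w, hΔ' s w hw, hΔ' s w' hw']
  have hest : ∀ x ∈ scaledSet (wordScale θ y n) τ (t s), x ∈ controlSet S θ c y v →
      |L x - g z₁ - ℓ (x - z₁)| ≤ η * (2 * Δ * wordScale θ y n) := by
    intro x hx hxc
    have h1 : dist x z₁ < ρ := by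
      rw [dist_eq_norm]
      refine (hclose x hx).trans_lt ?_
      linarith [hP n]
    have h2 := hev h1
    rw [hgL ⟨hxc, h2.2⟩]
    exact h2.1.trans (mul_le_mul_of_nonneg_left (hclose x hx) hη0.le)
  -- A copy of the edge inside the level-`n` tile around `z₁`: `a` and `b` are the control points of
  -- its tile and subtile.
  set a := wordScale θ y (n + q) • c i + τ' with ha
  set b := wordScale θ y (n + q + 1) • c j +
    (wordScale θ y (n + q) • (S l).shift i j k + τ') with hb
  have hab : b - a = wordScale θ y (n + q) • δ := by
    rw [ha, hb, hδ, wordScale_succ, hl, SubstitutionRule.f, (hθ _).2.2]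
    module
  have hEa := hest a (hsub' ⟨c i, hc i, rfl⟩) ⟨_, _, _, hs', rfl⟩
  have hEb := hest b (hsub' (image_mono ((S l).image_subset i j k)
    (by
      change b ∈ scaledSet (wordScale θ y (n + q)) τ' ((S l).f i j k '' t j)
      rw [← scaledSet_succ hθ hl]
      exact ⟨c j, hc j, rfl⟩)))
    ⟨_, _, _, hs'.succ hl j k, rfl⟩
  have hmain : |L (b - a) - ℓ (b - a)| ≤ η * (4 * Δ * wordScale θ y n) := by
    have : L (b - a) - ℓ (b - a) =
        (L b - g z₁ - ℓ (b - z₁)) - (L a - g z₁ - ℓ (a - z₁)) := by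
      rw [map_sub, map_sub, map_sub, map_sub]; ring
    rw [this]
    refine (abs_sub _ _).trans ?_
    linarith
  rw [hab, map_wordScale_smul L hL, map_smul, smul_eq_mul, ← mul_sub, abs_mul,
    abs_of_pos (hP _)] at hmain
  have h1 := (mul_le_mul_of_nonneg_right (hPq q n) (abs_nonneg (L δ - ℓ δ))).trans hmain
  have h2 : α ^ q * |L δ - ℓ δ| ≤ η * (4 * Δ) := by
    refine le_of_mul_le_mul_right ?_ (hP n)
    linarith
  have h3 : η * (4 * Δ) ≤ α ^ q * ε := by
    rw [hη, div_mul_eq_mul_div, div_le_iff₀ (by positivity)]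
    nlinarith [mul_pos hε (pow_pos hα q)]
  exact le_of_mul_le_mul_left (h2.trans h3) (pow_pos hα q)

/-- A path of positive length from `u` back to `u` has a first edge. -/
theorem IsMinimal.exists_edge {x : FullShift N} (hx : IsMinimal S x) (m : ℤ) (i : ℕ)
    (u : Fin M) : ∃ v, Nonempty (Fin ((S (fromLevel x m i)).κ v u)) := by
  obtain ⟨ℓ, hℓ, h⟩ := hx (m + i)
  obtain ⟨p, hp⟩ := h u u
  obtain ⟨v, hv⟩ := p.exists_first_edge hℓ
  rw [hp] at hv
  refine ⟨v, ?_⟩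
  have : fromLevel x (m + i) 0 = fromLevel x m i := by simp [fromLevel]
  rwa [this] at hv

/-! ### Refinement along the past of `x`. -/

/-- The symbols of `x` read downwards from the vertex level `0`. -/
def past (x : FullShift N) (m : ℕ) : Fin N := x (edgeLevel (-m - 1))

theorem fromLevel_neg_eq_past (x : FullShift N) {n i : ℕ} (hi : i < n) :
    fromLevel x (-n) i = past x (n - 1 - i) := by
  simp only [fromLevel, past]
  congr 2
  omega

theorem wordScale_fromLevel_neg (x : FullShift N) (n : ℕ) :
    wordScale θ (fromLevel x (-n)) n = wordScale θ (past x) n := by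
  rw [wordScale, wordScale, ← Finset.prod_range_reflect]
  refine Finset.prod_congr rfl fun i hi => ?_
  rw [Finset.mem_range] at hi
  rw [fromLevel_neg_eq_past x (by omega)]
  congr 2
  omega

/-- Functionals are bounded, uniformly in the scale, on the displacements of neighbouring tiles. -/
theorem exists_bound_of_neighbours (ht : ∀ i, IsCompact (t i)) (hne : ∀ i, (t i).Nonempty)
    (hθ : ∀ l, (S l).IsUniformlyExpanding (θ l)) (hS : Compatible S) (c : Fin M → Space d)
    {x : FullShift N} (hx : IsMinimal S x)
    (L : Space d →+ ℝ) (hL : ∀ l h, L (θ l • h) = θ l * L h) (v : Fin M) :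
    ∃ C : ℝ, 0 ≤ C ∧ ∀ n j τ j' τ', Subtile S θ (past x) v n j τ →
      Subtile S θ (past x) v n j' τ' →
      (scaledSet (wordScale θ (past x) n) τ (t j) ∩
        scaledSet (wordScale θ (past x) n) τ' (t j')).Nonempty →
      |L (wordScale θ (past x) n • c j + τ - (wordScale θ (past x) n • c j' + τ'))| ≤
        C * wordScale θ (past x) n := by
  obtain ⟨F, hF, hdisp⟩ := exists_finite_displacements ht hθ hS
  obtain ⟨C₁, hC₁⟩ := (hF.image fun u => |L u|).bddAbove
  obtain ⟨C₂, hC₂⟩ := (Set.finite_range fun p : Fin M × Fin M => |L (c p.1 - c p.2)|).bddAbove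
  have hC₂0 : 0 ≤ C₂ := (abs_nonneg _).trans (hC₂ ⟨(v, v), rfl⟩)
  refine ⟨max C₁ 0 + C₂, by positivity, ?_⟩
  intro n j τ j' τ' h h' hmeet
  have hP := wordScale_pos (fun l => (hθ l).1) (past x) n
  -- Seen from level `-n`, the refinement of `t v` is, up to an affine map, the `n`-th approximant
  -- of a path through `v`.
  obtain ⟨e, he⟩ := exists_infPath_through (S := S) hne (fromLevel x (-n))
    (hx.exists_edge (-n)) n v
  subst he
  obtain ⟨p, rfl, hp⟩ := h.exists_path hθ (fromLevel x (-n)) fun i => fromLevel_neg_eq_past x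
  obtain ⟨q, rfl, hq⟩ := h'.exists_path hθ (fromLevel x (-n)) fun i => fromLevel_neg_eq_past x
  have hmem := hdisp (fromLevel x (-n)) e n q p (by
    rw [funext hp, funext hq, inter_comm]
    exact hmeet)
  rw [wordScale_fromLevel_neg, hp, hq, smul_zero, zero_add, zero_add] at hmem
  have heq : wordScale θ (past x) n • c p.source + τ - (wordScale θ (past x) n • c q.source + τ')
      = wordScale θ (past x) n •
        ((wordScale θ (past x) n)⁻¹ • (τ - τ') + (c p.source - c q.source)) := by
    rw [smul_add, smul_inv_smul₀ hP.ne', smul_sub]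
    abel
  rw [heq, map_wordScale_smul L hL, abs_mul, abs_of_pos hP, mul_comm, map_add]
  refine mul_le_mul_of_nonneg_right ((abs_add_le _ _).trans (add_le_add ?_ ?_)) hP.le
  · exact (hC₁ ⟨_, hmem, rfl⟩).trans (le_max_left _ _)
  · exact hC₂ ⟨(p.source, q.source), rfl⟩

/-- The displacements of the control points along the edges of the positive part of `x`. -/
def edgeDisplacements (S : Fin N → SubstitutionRule t) (c : Fin M → Space d)
    (x : FullShift N) : Set (Space d) :=
  {h | ∃ n i j, ∃ k : Fin ((S (positivePart x n)).κ i j),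
    h = (S (positivePart x n)).f i j k (c j) - c i}

theorem finite_edgeDisplacements (c : Fin M → Space d) (x : FullShift N) :
    (edgeDisplacements S c x).Finite := by
  refine (Set.finite_range fun e : Σ l, Σ i, Σ j, Fin ((S l).κ i j) =>
    (S e.1).f e.2.1 e.2.2.1 e.2.2.2 (c e.2.2.1) - c e.2.1).subset ?_
  rintro _ ⟨n, i, j, k, rfl⟩
  exact ⟨⟨_, i, j, k⟩, rfl⟩

/-- Rigidity: a functional that commutes with the contraction constants is linear on the
displacements of the control points. -/
theorem rigidity (ht : ∀ i, IsCompact (t i)) (ht' : ∀ i, (interior (t i)).Nonempty)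
    (hθ : ∀ l, (S l).IsUniformlyExpanding (θ l)) (hS : Compatible S)
    {c : Fin M → Space d} (hc : ∀ i, c i ∈ t i)
    (hsub : ∀ l i, ∃ j, ∃ k : Fin ((S l).κ i j), (S l).f i j k (c j) = c i)
    {x : FullShift N} (hx : IsMinimal S x)
    (hrec : ∀ (i : ℤ) (q n₀ : ℕ), ∃ n ≥ n₀, ∀ k < q,
      x (edgeLevel (i - n + k)) = x (edgeLevel (i + k)))
    (L : Space d →+ ℝ) (hL : ∀ l h, L (θ l • h) = θ l * L h) :
    ∃ ℓ : Space d →ₗ[ℝ] ℝ, ∀ h ∈ edgeDisplacements S c x, L h = ℓ h := by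
  rcases isEmpty_or_nonempty (Fin M) with hM | ⟨⟨v⟩⟩
  · refine ⟨0, ?_⟩
    rintro _ ⟨_, i, -⟩
    exact hM.elim i
  obtain ⟨C, hC0, hC⟩ := exists_bound_of_neighbours ht
    (fun i => (ht' i).mono interior_subset) hθ hS c hx L hL v
  obtain ⟨ℓ, hℓ⟩ := exists_linear_of_bounded hθ ht ht' hc hsub L hL (past x) v hC0 hC
  refine ⟨ℓ, ?_⟩
  rintro _ ⟨m, i, j, k, rfl⟩
  refine hℓ _ i j k ?_
  obtain ⟨q, -, hq⟩ := hx (m + 1)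
  refine ⟨q, fun n₀ => ?_⟩
  -- The recurring word is the edge in question followed by the `q` levels that join all vertices.
  -- With `n' = m + 1 + q + n`, the top of its copy lies at level `-n`: every tile of depth `n`
  -- contains one of type `i` at depth `n + q`, where the edge follows.
  obtain ⟨n', hn', hword⟩ := hrec m (1 + q) (n₀ + m + 1 + q)
  obtain ⟨n, rfl⟩ := Nat.exists_eq_add_of_le (show m + 1 + q ≤ n' by omega)
  refine ⟨n, by omega, fun s τ hs => ?_⟩
  obtain ⟨p, rfl⟩ := hq i s
  obtain ⟨τ', h, hsub'⟩ := hs.descend hθ p (fun a ha => by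
    have := hword (a + 1) (by omega)
    simp only [fromLevel, past]
    rw [show (m : ℤ) + 1 + a = m + (a + 1 : ℕ) by push_cast; ring, ← this]
    congr 2
    push_cast
    omega)
  refine ⟨τ', h, ?_, hsub'⟩
  have := hword 0 (by omega)
  simp only [positivePart, fromLevel, past]
  rw [show (0 : ℤ) + m = m + (0 : ℕ) by push_cast; ring, ← this]
  congr 2
  push_cast
  ring

/-! ### Return vectors -/

/-- Appending the next edge of `e` to both paths leaves the tile unchanged, since its map cancels.
-/
theorem approximant_mono {w : ℕ → Fin N}
    (e : InfPath S w) : Monotone (approximant e) := by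
  refine monotone_nat_of_le_succ fun n => ?_
  rintro _ ⟨p, rfl⟩
  refine ⟨.snoc p (e.vertex (n + 1)) (e.edge n), ?_⟩
  have hinj : Function.Injective ((S (w n)).f (e.vertex (n + 1)) (e.vertex n) (e.edge n)) :=
    (affineHomeo ((S (w n)).scale_pos _ _ _).ne' _).injective
  simp only [placed, InfPath.trunc, Path.map, Path.source]
  rw [preimage_comp, image_comp, preimage_image_eq _ hinj]

/-- A telescoping sum: each edge adds its displacement divided by the current scale, and the inverse
scale lies in `R`. -/
theorem Path.displacement_mem {w : ℕ → Fin N} (hθ : ∀ l, (S l).IsUniformlyExpanding (θ l))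
    {R : Subring ℝ} (hR : ∀ l, (θ l)⁻¹ ∈ R) {c : Fin M → Space d} (Λ : Submodule R (Space d))
    (hΛ : ∀ n i j, ∀ k : Fin ((S (w n)).κ i j), (S (w n)).f i j k (c j) - c i ∈ Λ)
    {n : ℕ} {v : Fin M} (p : Path S w n v) :
    (wordScale θ w n)⁻¹ • (p.map (c p.source) - c v) ∈ Λ := by
  have hmem : ∀ n, (wordScale θ w n)⁻¹ ∈ R := by
    intro n
    rw [wordScale, ← Finset.prod_inv_distrib]
    exact R.prod_mem fun i _ => hR _
  induction p with
  | nil v => simp [Path.map, Path.source]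
  | @snoc n u p v k ih =>
    have hpos := (hθ (w n)).1.ne'
    have heq : (wordScale θ w (n + 1))⁻¹ •
        ((Path.snoc p v k).map (c (Path.snoc p v k).source) - c v) =
        (wordScale θ w n)⁻¹ • (p.map (c p.source) - c u) +
        (⟨_, hmem (n + 1)⟩ : R) • ((S (w n)).f v u k (c u) - c v) := by
      rw [Subring.smul_def]
      simp only [Path.map, Path.source, Function.comp_apply, SubstitutionRule.f,
        (hθ (w n)).2.2, wordScale_succ, mul_inv]
      have : (wordScale θ w n)⁻¹ • (p.map (c p.source) - c u) =
          ((wordScale θ w n)⁻¹ * (θ (w n))⁻¹) • θ (w n) • (p.map (c p.source) - c u) := by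
        rw [smul_smul, mul_assoc, inv_mul_cancel₀ hpos, mul_one]
      rw [this]
      module
    rw [heq]
    exact Λ.add_mem ih (Λ.smul_mem _ (hΛ _ _ _ _))

theorem shiftSet_shiftSet (u u' : Space d) (A : Set (Space d)) :
    shiftSet u (shiftSet u' A) = shiftSet (u' + u) A := by
  simp only [shiftSet, image_image, add_assoc]

/-- A return vector of a tiling in the tiling space is one of an approximant. -/
theorem exists_paths_of_mem_returnVectorsAt (hθ : ∀ l, (S l).IsUniformlyExpanding (θ l))
    {c : Fin M → Space d} (hshift : ∀ i j u, shiftSet u (t i) = t j → c i + u = c j)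
    {x : FullShift N} {τ : Space d} (hτ : τ ∈ returnVectorsAt S x) :
    ∃ n v, ∃ p q : Path S (positivePart x) n v, τ = (wordScale θ (positivePart x) n)⁻¹ •
      (q.map (c q.source) - p.map (c p.source)) := by
  simp only [returnVectorsAt, returnVectors, mem_iUnion] at hτ
  obtain ⟨T, ⟨e, -, htil, hcl⟩, -, A, hA, B, hB, -, -, hAB⟩ := hτ
  obtain ⟨r, hr⟩ := ((htil.compact A hA).union (htil.compact B hB)).isBounded.exists_norm_le
  -- The ball of radius `1 / ε = |r| + 1` contains both tiles.
  have hε : 0 < 1 / (|r| + 1) := by positivity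
  obtain ⟨u, s, -, hpatch⟩ := hcl _ hε
  rw [one_div_one_div] at hpatch
  have hfind : ∀ D ∈ T, D ⊆ A ∪ B → ∃ D' ∈ tilingOf e, D = shiftSet (u + s) D' := by
    intro D hD hDs
    have : D ∈ patchIn T (Metric.ball 0 (|r| + 1)) := by
      refine ⟨hD, fun z hz => ?_⟩
      rw [mem_ball_zero_iff]
      have := hr z (hDs hz)
      have := le_abs_self r
      linarith
    rw [hpatch] at this
    obtain ⟨_, ⟨D', hD', rfl⟩, rfl⟩ := this.1
    exact ⟨D', hD', shiftSet_shiftSet _ _ _⟩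
  obtain ⟨A', hA', rfl⟩ := hfind A hA subset_union_left
  obtain ⟨B', hB', rfl⟩ := hfind B hB subset_union_right
  simp only [tilingOf, mem_iUnion] at hA' hB'
  obtain ⟨n, hn⟩ := hA'
  obtain ⟨m, hm⟩ := hB'
  obtain ⟨p, rfl⟩ := approximant_mono e (le_max_left n m) hn
  obtain ⟨q, rfl⟩ := approximant_mono e (le_max_right n m) hm
  refine ⟨max n m, _, p, q, ?_⟩
  simp only [placed_eq hθ, shiftSet_shiftSet] at hAB
  have h := congrArg (shiftSet (-((wordScale θ (positivePart x) (max n m))⁻¹ •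
    (q.map 0 - (e.trunc (max n m)).map 0) + (u + s)))) hAB
  rw [shiftSet_shiftSet, shiftSet_shiftSet, add_neg_cancel] at h
  have h0 : shiftSet 0 (t q.source) = t q.source := by simp [shiftSet]
  -- The two sources may be different indices whose prototiles are translates of each other; control
  -- points follow such translations.
  have h1 := hshift _ _ _ (h.trans h0)
  have hP := (wordScale_pos (fun l => (hθ l).1) (positivePart x) (max n m)).ne'
  rw [q.map_eq hθ, p.map_eq hθ, ← h1]
  have h2 : ∀ z : Space d, z = (wordScale θ (positivePart x) (max n m))⁻¹ •
      wordScale θ (positivePart x) (max n m) • z := fun z => (inv_smul_smul₀ hP z).symm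
  rw [add_sub_add_comm, ← smul_sub, smul_add, ← h2]
  module

end

end RandomTiling

theorem theorem4 {d M N : ℕ} (t : Fin M → Set (RandomTiling.Space d))
    (ht : ∀ i, IsCompact (t i)) (ht' : ∀ i, (interior (t i)).Nonempty)
    (S : Fin N → RandomTiling.SubstitutionRule t) (θ : Fin N → ℝ)
    (hθ : ∀ l, (S l).IsUniformlyExpanding (θ l))
    (hS : RandomTiling.Compatible S)
    (μ : MeasureTheory.Measure (RandomTiling.FullShift N)) [MeasureTheory.IsProbabilityMeasure μ]
    (hμ : Ergodic (RandomTiling.shiftMap N) μ)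
    (hmin : ∀ᵐ x ∂μ, RandomTiling.IsMinimal S x) :
    ∀ᵐ x ∂μ, ∃ b : Module.Basis (Fin d) ℝ (RandomTiling.Space d),
      ∀ τ ∈ RandomTiling.returnVectorsAt S x, ∃ c : Fin d → ℝ,
        (∀ i, c i ∈ Algebra.adjoin ℤ (Set.range fun l => (θ l)⁻¹)) ∧
        τ = ∑ i, c i • b i := by
  obtain ⟨c, hc, hsub, hshift⟩ := RandomTiling.exists_controlPoints ht ht' S
  filter_upwards [hmin, RandomTiling.ae_recurrent μ hμ.toMeasurePreserving] with x hx hrec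
  let R : Subring ℝ := (Algebra.adjoin ℤ (Set.range fun l => (θ l)⁻¹)).toSubring
  have hR : ∀ l, (θ l)⁻¹ ∈ R := fun l => Algebra.subset_adjoin ⟨l, rfl⟩
  obtain ⟨b, hb⟩ := RandomTiling.exists_basis_of_rigid R
    (RandomTiling.finite_edgeDisplacements (S := S) c x) fun L =>
      RandomTiling.rigidity ht ht' hθ hS hc hsub hx hrec L.toAddMonoidHom fun l h => by
        -- The fraction field contains `θ l`, so `K`-linearity makes `L` commute with the
        -- contractions.
        have hK : θ l ∈ Subfield.closure (R : Set ℝ) := by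
          simpa using inv_mem (Subfield.subset_closure (s := (R : Set ℝ)) (hR l))
        exact L.map_smul (⟨θ l, hK⟩ : Subfield.closure (R : Set ℝ)) h
  refine ⟨b, fun τ hτ => ?_⟩
  obtain ⟨n, v, p, q, rfl⟩ :=
    RandomTiling.exists_paths_of_mem_returnVectorsAt hθ hshift hτ
  have hΛ : ∀ n i j, ∀ k : Fin ((S (RandomTiling.positivePart x n)).κ i j),
      (S (RandomTiling.positivePart x n)).f i j k (c j) - c i ∈
        Submodule.span R (Set.range b) := by
    intro n i j k
    obtain ⟨a, ha, heq⟩ := hb _ ⟨n, i, j, k, rfl⟩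
    rw [heq]
    exact Submodule.sum_mem _ fun i _ =>
      Submodule.smul_mem _ (⟨a i, ha i⟩ : R) (Submodule.subset_span ⟨i, rfl⟩)
  have hmem := Submodule.sub_mem _ (q.displacement_mem hθ hR _ hΛ)
    (p.displacement_mem hθ hR _ hΛ)
  -- Both paths end at `v`, so `c v` cancels.
  rw [← smul_sub, sub_sub_sub_cancel_right] at hmem
  obtain ⟨a, ha⟩ := (Submodule.mem_span_range_iff_exists_fun R).1 hmem
  exact ⟨fun i => a i, fun i => (a i).2, ha.symm⟩
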